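/- **Setting.** Let $l_1,\dots,l_n:\mathbb R\times\mathbb R\to\mathbb R$ be convex and twice differentiable in the first argument, $R:\mathbb R^d\to\mathbb R$ twice differentiable, $X\in\mathbb R^{n\times d}$ a random matrix, $y\in\mathbb R^n$ a (possibly random) vector, and $$Q(\beta)=\frac1n\sum_{i=1}^n l_i(X_{i\cdot}\beta,y_i)+R(\beta),$$ which is assumed to be convex. For a positive integer $s<n$ put $\mathcal D_s=\{\beta:\|\beta\|_0\le s,\ Q(\beta)\le Q(0)\}$, where $\|\beta\|_0$ is the number of nonzero entries. For $r\le s$ let $\rho_-(r)$ and $\rho_+(r)$ be the largest and the smallest constants in $[0,\infty]$ such that $$\tfrac{\rho_-(r)}2\|\beta'-\beta\|^2\le Q(\beta')-Q(\beta)-\langle\nabla Q(\beta),\beta'-\beta\rangle\le\tfrac{\rho_+(r)}2\|\beta'-\beta\|^2$$ for all $\beta,\beta'\in\mathcal D_s$ with $\|\beta'-\beta\|_0\le r$, and let $\kappa(s)=\rho_+(s)/\rho_-(s)$ (if $\mathcal D_s$ contains no such pair with $\beta\neq\beta'$, then $\rho_+(r)=0$ and $\rho_-(r)=\infty$). **FoBa.**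 Put $\hat\beta(F)\in\arg\min_{\mathrm{supp}(\beta)\subseteq F}Q(\beta)$. FoBa starts with $k=0$, $F^{(0)}=\emptyset$, $\beta^{(0)}=0$ and repeats the following. *Stopping test:* stop if $Q(\beta^{(k)})-\min_{\alpha,\,j\notin F^{(k)}}Q(\beta^{(k)}+\alpha e_j)<\delta$ (FoBa-obj), respectively $\|\nabla Q(\beta^{(k)})\|_\infty<\epsilon$ (FoBa-gdt). *Forward step:* choose $i\in\arg\min_{i\notin F^{(k)}}\min_\alpha Q(\beta^{(k)}+\alpha e_i)$ (FoBa-obj), respectively $i\in\arg\max_{i\notin F^{(k)}}|\nabla Q(\beta^{(k)})_i|$ (FoBa-gdt); set $F^{(k+1)}=F^{(k)}\cup\{i\}$, $\beta^{(k+1)}=\hat\beta(F^{(k+1)})$, $\delta^{(k+1)}=Q(\beta^{(k)})-Q(\beta^{(k+1)})$, $k\leftarrow k+1$. *Backward step:* while $\min_{i\in F^{(k)}}Q(\beta^{(k)}-\beta^{(k)}_ie_i)-Q(\beta^{(k)})<\delta^{(k)}/2$, remove a minimizing $i$ from $F^{(k)}$, set $F^{(k-1)}=F^{(k)}\setminus\{i\}$,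 $\beta^{(k-1)}=\hat\beta(F^{(k-1)})$, $k\leftarrow k-1$. Minimizers are chosen arbitrarily in case of ties. The counter $k$ is the number of selected features. **Assumptions.** Let $\lambda^-,\lambda_R^-,\lambda_R^+\ge0$ and $\lambda^+>0$ be such that $\lambda_R^-+0.5\lambda^->0$, $$\lambda^-\le\nabla_1^2l_i(X_{i\cdot}\beta,y_i)\le\lambda^+\quad\text{for all } i \text{ and all } \beta\in\mathcal D_s,$$ and $\lambda_R^-I\preceq\nabla^2R(\theta)\preceq\lambda_R^+I$ for all $\theta\in\mathcal D_s$ and, more generally, all $\theta$ on a segment joining two points of $\mathcal D_s$ that differ in at most $s$ coordinates. Let $X$ have either independent isotropic sub-Gaussian rows, or independent isotropic sub-Gaussian columns with $\|X_{\cdot j}\|=\sqrt n$ almost surely; the sub-Gaussian ($\psi_2$) norms of these vectors are at most $K$. Here a random vector $Z$ is isotropic if $\mathbb E ZZ^\top=I$, and $\|Z\|_{\psi_2}\le K$ means $\mathbb E\exp(\langle Z,u\rangle^2/K^2)\le2$ for all unit vectors $u$. **Theorem.** There is a constant $C>0$ that depends only on $K$ such that, if $n\ge Cs\log d$, then with probability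 tending to $1$ as $n\to\infty$, uniformly in $d$, $s$, $l_i$, $R$, $y$, the $\lambda$'s and the law of $X$ under these assumptions, $$\rho_+(s)\le\lambda_R^++1.5\lambda^+,\qquad\rho_-(s)\ge\lambda_R^-+0.5\lambda^-,\qquad\kappa(s)\le\kappa:=\frac{\lambda_R^++1.5\lambda^+}{\lambda_R^-+0.5\lambda^-},$$ and the following holds for every integer $\bar k\ge0$ with $s\ge\bar k+4\kappa^2(\sqrt\kappa+1)^2(\bar k+1)$: $$s-\bar k>(\bar k+1)\left[\left(\sqrt{\frac{\rho_+(s)}{\rho_-(s)}}+1\right)\frac{2\rho_+(1)}{\rho_-(s)}\right]^2,$$ and if $\bar\beta$ has at most $\bar k$ nonzero entries and minimizes $Q$ over the vectors supported in $\mathrm{supp}(\bar\beta)$ (for instance, if $\bar\beta$ minimizes $Q$ over all vectors with at most $\bar k$ nonzero entries), then FoBa-obj with any $\delta>0$ such that $\delta>\frac{4\rho_+(1)}{\rho_-(s)^2}\|\nabla Q(\bar\beta)\|_\infty^2$, and FoBa-gdt with any $\epsilon>0$ such that $\epsilon>\frac{2\sqrt2\rho_+(1)}{\rho_-(s)}\|\nabla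 Q(\bar\beta)\|_\infty$, terminate at some $k\le4\kappa^2(\sqrt\kappa+1)^2(\bar k+1)$. More precisely, the assumptions of convexity of $Q$ and of the curvature bounds may themselves be random events: the probability that they hold and the conclusion fails tends to $0$. -/

import Mathlib

open MeasureTheory ProbabilityTheory
open scoped ENNReal

namespace FoBa

/-- The parameter space `ℝ^d` with its Euclidean norm. -/
abbrev Vec (d : ℕ) : Type := EuclideanSpace ℝ (Fin d)

/-- The support `supp(β)`. -/
noncomputable def supp {d : ℕ} (β : Vec d) : Finset (Fin d) :=
  Finset.univ.filter fun j => β j ≠ 0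

/-- The number of nonzero entries `‖β‖₀`. -/
noncomputable def l0 {d : ℕ} (β : Vec d) : ℕ := (supp β).card

/-- The objective `Q(β) = (1/n) ∑ᵢ lᵢ(Xᵢ. β, yᵢ) + R(β)`. -/
noncomputable def objective {n d : ℕ} (l : Fin n → ℝ → ℝ → ℝ) (R : Vec d → ℝ)
    (X : Matrix (Fin n) (Fin d) ℝ) (y : Fin n → ℝ) (β : Vec d) : ℝ :=
  (1 / (n : ℝ)) * ∑ i, l i (X.mulVec β.ofLp i) (y i) + R β

/-! ### Restricted strong convexity constants -/

/-- `D_s = {β : ‖β‖₀ ≤ s, Q(β) ≤ Q(0)}`. -/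
def sublevel {d : ℕ} (Q : Vec d → ℝ) (s : ℕ) : Set (Vec d) :=
  {β | l0 β ≤ s ∧ Q β ≤ Q 0}

/-- `Q(β') - Q(β) - ⟨∇Q(β), β' - β⟩`. -/
noncomputable def bregman {d : ℕ} (Q : Vec d → ℝ) (β β' : Vec d) : ℝ :=
  Q β' - Q β - inner ℝ (gradient Q β) (β' - β)

/-- Pairs of distinct points of `D_s` that differ in at most `r` coordinates. -/
def sparsePairs {d : ℕ} (Q : Vec d → ℝ) (s r : ℕ) : Set (Vec d × Vec d) :=
  {p | p.1 ∈ sublevel Q s ∧ p.2 ∈ sublevel Q s ∧ l0 (p.2 - p.1) ≤ r ∧ p.1 ≠ p.2}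

/-- `ρ₊(r)` over the domain `D_s`: the least constant in `[0, ∞]` with
`Q(β') - Q(β) - ⟨∇Q(β), β' - β⟩ ≤ (ρ₊(r) / 2) ‖β' - β‖²` for all `β, β' ∈ D_s`
with `‖β' - β‖₀ ≤ r`. -/
noncomputable def rhoPlus {d : ℕ} (Q : Vec d → ℝ) (s r : ℕ) : ℝ≥0∞ :=
  ⨆ p ∈ sparsePairs Q s r, ENNReal.ofReal (2 * bregman Q p.1 p.2 / ‖p.2 - p.1‖ ^ 2)

/-- `ρ₋(r)` over the domain `D_s`: the largest constant in `[0, ∞]` with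
`(ρ₋(r) / 2) ‖β' - β‖² ≤ Q(β') - Q(β) - ⟨∇Q(β), β' - β⟩` for all `β, β' ∈ D_s`
with `‖β' - β‖₀ ≤ r`; it is `∞` if there is no such pair with `β ≠ β'`.
(`Q` is convex, so the quotients are nonnegative.) -/
noncomputable def rhoMinus {d : ℕ} (Q : Vec d → ℝ) (s r : ℕ) : ℝ≥0∞ :=
  ⨅ p ∈ sparsePairs Q s r, ENNReal.ofReal (2 * bregman Q p.1 p.2 / ‖p.2 - p.1‖ ^ 2)

/-- The condition number `κ(s) = ρ₊(s) / ρ₋(s)`. -/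
noncomputable def condNumber {d : ℕ} (Q : Vec d → ℝ) (s : ℕ) : ℝ≥0∞ :=
  rhoPlus Q s s / rhoMinus Q s s

/-- The curvature bounds: `λ⁻ ≤ ∇₁² lᵢ(Xᵢ. β, yᵢ) ≤ λ⁺` for all `i` and `β ∈ D_s`, and
`λ_R⁻ I ≼ ∇² R(θ) ≼ λ_R⁺ I` at every `θ ∈ D_s` and, more generally, at every `θ` on a segment
joining two points of `D_s` that differ in at most `s` coordinates. -/
structure CurvatureBounds {n d : ℕ} (l : Fin n → ℝ → ℝ → ℝ) (R : Vec d → ℝ)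
    (X : Matrix (Fin n) (Fin d) ℝ) (y : Fin n → ℝ) (s : ℕ)
    (lamMinus lamPlus lamRMinus lamRPlus : ℝ) : Prop where
  loss : ∀ β ∈ sublevel (objective l R X y) s, ∀ i,
    lamMinus ≤ deriv (deriv fun u => l i u (y i)) (X.mulVec β.ofLp i) ∧
      deriv (deriv fun u => l i u (y i)) (X.mulVec β.ofLp i) ≤ lamPlus
  reg : ∀ β ∈ sublevel (objective l R X y) s, ∀ β' ∈ sublevel (objective l R X y) s,
    l0 (β' - β) ≤ s → ∀ θ ∈ segment ℝ β β', ∀ v : Vec d,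
      lamRMinus * ‖v‖ ^ 2 ≤ fderiv ℝ (fderiv ℝ R) θ v v ∧
        fderiv ℝ (fderiv ℝ R) θ v v ≤ lamRPlus * ‖v‖ ^ 2

/-! ### Random matrices with sub-Gaussian isotropic rows or columns -/

section Random

variable {Ω : Type*} [MeasurableSpace Ω]

/-- Sub-Gaussian random vector with `ψ₂`-norm at most `K`: `E exp(⟨Z, u⟩² / K²) ≤ 2` for every
unit vector `u`. -/
def SubGaussianVec {m : ℕ} (μ : Measure Ω) (Z : Ω → Vec m) (K : ℝ) : Prop :=
  ∀ u : Vec m, ‖u‖ = 1 →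
    ∫⁻ ω, ENNReal.ofReal (Real.exp ((inner ℝ (Z ω) u) ^ 2 / K ^ 2)) ∂μ ≤ 2

/-- Isotropic random vector: `E Z Zᵀ = I`. -/
def IsotropicVec {m : ℕ} (μ : Measure Ω) (Z : Ω → Vec m) : Prop :=
  ∀ a b : Fin m, Integrable (fun ω => Z ω a * Z ω b) μ ∧
    ∫ ω, Z ω a * Z ω b ∂μ = if a = b then 1 else 0

/-- The `i`-th row of a random matrix. -/
def rowVec {n d : ℕ} (X : Ω → Matrix (Fin n) (Fin d) ℝ) (i : Fin n) (ω : Ω) : Vec d :=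
  WithLp.toLp 2 fun j => X ω i j

/-- The `j`-th column of a random matrix. -/
def colVec {n d : ℕ} (X : Ω → Matrix (Fin n) (Fin d) ℝ) (j : Fin d) (ω : Ω) : Vec n :=
  WithLp.toLp 2 fun i => X ω i j

/-- The rows are independent, isotropic and sub-Gaussian (with `ψ₂`-norms at most `K`). -/
structure IndepRows {n d : ℕ} (μ : Measure Ω) (X : Ω → Matrix (Fin n) (Fin d) ℝ)
    (K : ℝ) : Prop where
  meas : ∀ i, Measurable (rowVec X i)
  indep : iIndepFun (rowVec X) μ
  isotropic : ∀ i, IsotropicVec μ (rowVec X i)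
  subGaussian : ∀ i, SubGaussianVec μ (rowVec X i) K

/-- The columns are independent, isotropic and sub-Gaussian (with `ψ₂`-norms at most `K`), and
have Euclidean norm `√n` almost surely. -/
structure IndepCols {n d : ℕ} (μ : Measure Ω) (X : Ω → Matrix (Fin n) (Fin d) ℝ)
    (K : ℝ) : Prop where
  meas : ∀ j, Measurable (colVec X j)
  indep : iIndepFun (colVec X) μ
  isotropic : ∀ j, IsotropicVec μ (colVec X j)
  subGaussian : ∀ j, SubGaussianVec μ (colVec X j) K
  norm_eq : ∀ j, ∀ᵐ ω ∂μ, ‖colVec X j ω‖ = Real.sqrt n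

end Random

/-! ### The forward-backward greedy algorithms -/

/-- `β = argmin {Q(β') : supp(β') ⊆ F}`, that is, `β` is a possible value of `β̂(F)`. -/
def IsRestrictedMin {d : ℕ} (Q : Vec d → ℝ) (F : Finset (Fin d)) (β : Vec d) : Prop :=
  supp β ⊆ F ∧ ∀ β' : Vec d, supp β' ⊆ F → Q β ≤ Q β'

/-- The vector `β + α e_j`. -/
noncomputable def move {d : ℕ} (β : Vec d) (j : Fin d) (α : ℝ) : Vec d :=
  β + α • EuclideanSpace.single j (1 : ℝ)

/-- The two variants, FoBa-obj and FoBa-gdt. -/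
inductive Variant : Type
  | obj
  | gdt

/-- The stopping test with threshold `τ` (which is `δ` for FoBa-obj and `ε` for FoBa-gdt):
`Q(β) - min_{α, j ∉ F} Q(β + α e_j) < δ`, respectively `‖∇Q(β)‖_∞ < ε`. -/
def Stop {d : ℕ} (Q : Vec d → ℝ) (τ : ℝ) (F : Finset (Fin d)) (β : Vec d) : Variant → Prop
  | .obj => ∀ j, j ∉ F → ∀ α : ℝ, Q β - Q (move β j α) < τ
  | .gdt => ∀ j, |gradient Q β j| < τ

/-- The forward selection rule: `i ∈ argmin_{i ∉ F} min_α Q(β + α e_i)`, respectively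
`i ∈ argmax_{i ∉ F} |∇Q(β)_i|`. Ties may be broken in any way. -/
def Selects {d : ℕ} (Q : Vec d → ℝ) (F : Finset (Fin d)) (β : Vec d) (i : Fin d) :
    Variant → Prop
  | .obj => i ∉ F ∧ ∃ α₀ : ℝ, ∀ j, j ∉ F → ∀ α : ℝ, Q (move β i α₀) ≤ Q (move β j α)
  | .gdt => i ∉ F ∧ ∀ j, j ∉ F → |gradient Q β j| ≤ |gradient Q β i|

/-- Control points: the head of the outer loop, the head of the inner (backward) loop, and the
end of the algorithm. -/
inductive Phase : Type
  | outer
  | inner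
  | halted

/-- A state of the algorithm: the control point, the counter `k`, the feature set `F^(k)`, the
vector `β^(k)` and the stored gains `δ^(1), δ^(2), …`. -/
structure State (d : ℕ) : Type where
  phase : Phase
  k : ℕ
  F : Finset (Fin d)
  β : Vec d
  gain : ℕ → ℝ

/-- The initial state `k = 0`, `F^(0) = ∅`, `β^(0) = 0`. -/
def initState (d : ℕ) : State d := ⟨.outer, 0, ∅, 0, fun _ => 0⟩

/-- One step of the algorithm. -/
inductive Step {d : ℕ} (Q : Vec d → ℝ) (v : Variant) (τ : ℝ) : State d → State d → Prop
  /-- The stopping test succeeds. -/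
  | finish (k : ℕ) (F : Finset (Fin d)) (β : Vec d) (g : ℕ → ℝ) (h : Stop Q τ F β v) :
      Step Q v τ ⟨.outer, k, F, β, g⟩ ⟨.halted, k, F, β, g⟩
  /-- The stopping test fails: select a feature, refit, store the gain `δ^(k+1)`. -/
  | forward (k : ℕ) (F : Finset (Fin d)) (β : Vec d) (g : ℕ → ℝ) (i : Fin d) (β' : Vec d)
      (h : ¬ Stop Q τ F β v) (hi : Selects Q F β i v)
      (hβ' : IsRestrictedMin Q (insert i F) β') :
      Step Q v τ ⟨.outer, k, F, β, g⟩
        ⟨.inner, k + 1, insert i F, β', Function.update g (k + 1) (Q β - Q β')⟩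
  /-- Leave the backward loop: `min_{i ∈ F} Q(β - β_i e_i) - Q(β) ≥ δ^(k) / 2`. -/
  | leave (k : ℕ) (F : Finset (Fin d)) (β : Vec d) (g : ℕ → ℝ)
      (h : ∀ i ∈ F, g k / 2 ≤ Q (move β i (-β i)) - Q β) :
      Step Q v τ ⟨.inner, k, F, β, g⟩ ⟨.outer, k, F, β, g⟩
  /-- Otherwise remove a feature of `argmin_{i ∈ F} Q(β - β_i e_i)` and refit. -/
  | backward (k : ℕ) (F : Finset (Fin d)) (β : Vec d) (g : ℕ → ℝ) (i : Fin d) (β' : Vec d)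
      (hi : i ∈ F) (hmin : ∀ j ∈ F, Q (move β i (-β i)) ≤ Q (move β j (-β j)))
      (h : Q (move β i (-β i)) - Q β < g k / 2)
      (hβ' : IsRestrictedMin Q (F.erase i) β') :
      Step Q v τ ⟨.inner, k, F, β, g⟩ ⟨.inner, k - 1, F.erase i, β', g⟩

/-- Every run of the algorithm is finite, and a run that cannot be continued has halted through
the stopping test (it is not blocked by a minimum that is not attained), with `k ≤ M`. -/
def TerminatesWithin {d : ℕ} (Q : Vec d → ℝ) (v : Variant) (τ M : ℝ) : Prop :=
  (¬ ∃ run : ℕ → State d, run 0 = initState d ∧ ∀ t, Step Q v τ (run t) (run (t + 1))) ∧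
    ∀ σ : State d, Relation.ReflTransGen (Step Q v τ) (initState d) σ →
      (∀ σ', ¬ Step Q v τ σ σ') → σ.phase = Phase.halted ∧ (σ.k : ℝ) ≤ M

/-- The sup norm `‖∇Q(β)‖_∞`. -/
noncomputable def gradSup {d : ℕ} (Q : Vec d → ℝ) (β : Vec d) : ℝ :=
  ‖(gradient Q β).ofLp‖

/-- `δ > (4 ρ₊(1) / ρ₋(s)²) ‖∇Q(β̄)‖_∞²` and `δ > 0`. -/
def AdmissibleDelta {d : ℕ} (Q : Vec d → ℝ) (s : ℕ) (βbar : Vec d) (δ : ℝ) : Prop :=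
  0 < δ ∧ 4 * rhoPlus Q s 1 / rhoMinus Q s s ^ 2 * ENNReal.ofReal (gradSup Q βbar ^ 2)
    < ENNReal.ofReal δ

/-- `ε > (2 √2 ρ₊(1) / ρ₋(s)) ‖∇Q(β̄)‖_∞` and `ε > 0`. -/
def AdmissibleEps {d : ℕ} (Q : Vec d → ℝ) (s : ℕ) (βbar : Vec d) (ε : ℝ) : Prop :=
  0 < ε ∧ ENNReal.ofReal (2 * Real.sqrt 2) * rhoPlus Q s 1 / rhoMinus Q s s
    * ENNReal.ofReal (gradSup Q βbar) < ENNReal.ofReal ε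

/-- `s - k̄ > (k̄ + 1) [(√(ρ₊(s)/ρ₋(s)) + 1) 2ρ₊(1)/ρ₋(s)]²`. -/
def SparsityCondition {d : ℕ} (Q : Vec d → ℝ) (s kbar : ℕ) : Prop :=
  ((kbar : ℝ≥0∞) + 1) * (((condNumber Q s) ^ (1 / 2 : ℝ) + 1)
    * (2 * rhoPlus Q s 1 / rhoMinus Q s s)) ^ 2 < ENNReal.ofReal ((s : ℝ) - kbar)

/-- `κ = (λ_R⁺ + 1.5 λ⁺) / (λ_R⁻ + 0.5 λ⁻)`. -/
noncomputable def kappa (lamMinus lamPlus lamRMinus lamRPlus : ℝ) : ℝ :=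
  (lamRPlus + 1.5 * lamPlus) / (lamRMinus + 0.5 * lamMinus)

/-- `4 κ² (√κ + 1)² (k̄ + 1)`. -/
noncomputable def iterBound (κ : ℝ) (kbar : ℕ) : ℝ :=
  4 * κ ^ 2 * (Real.sqrt κ + 1) ^ 2 * ((kbar : ℝ) + 1)

/-- The bounds on `ρ₊(s)`, `ρ₋(s)` and `κ(s)`. -/
def RSCBounds {d : ℕ} (Q : Vec d → ℝ) (s : ℕ)
    (lamMinus lamPlus lamRMinus lamRPlus : ℝ) : Prop :=
  rhoPlus Q s s ≤ ENNReal.ofReal (lamRPlus + 1.5 * lamPlus) ∧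
    ENNReal.ofReal (lamRMinus + 0.5 * lamMinus) ≤ rhoMinus Q s s ∧
    condNumber Q s ≤ ENNReal.ofReal (kappa lamMinus lamPlus lamRMinus lamRPlus)

/-- For every `k̄` with `s ≥ k̄ + 4 κ² (√κ + 1)² (k̄ + 1)`: the sparsity condition holds, and for
every `β̄` with at most `k̄` nonzero entries that minimizes `Q` over the vectors supported in
`supp(β̄)` (in particular for a minimizer over all vectors with at most `k̄` nonzero entries),
both variants with admissible thresholds terminate at some `k ≤ 4 κ² (√κ + 1)² (k̄ + 1)`. -/
def TerminationBounds {d : ℕ} (Q : Vec d → ℝ) (s : ℕ) (κ : ℝ) : Prop :=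
  ∀ kbar : ℕ, (kbar : ℝ) + iterBound κ kbar ≤ s →
    SparsityCondition Q s kbar ∧
    ∀ βbar : Vec d, l0 βbar ≤ kbar → IsRestrictedMin Q (supp βbar) βbar →
      (∀ δ : ℝ, AdmissibleDelta Q s βbar δ →
        TerminatesWithin Q Variant.obj δ (iterBound κ kbar)) ∧
      (∀ ε : ℝ, AdmissibleEps Q s βbar ε →
        TerminatesWithin Q Variant.gdt ε (iterBound κ kbar))

end FoBa

/-!
# FoBa under restricted isometry

**The design matrix.** With high probability `0.6 ‖v‖² ≤ ‖X v‖² / n ≤ 1.4 ‖v‖²` for all `s`-sparse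
`v` (`FoBa.RestrictedIsometry`, `FoBa.exists_measure_not_restrictedIsometry_le`). For a fixed unit
vector this is Chernoff's bound (`FoBa.measure_gramForm_deviation_le`). With independent rows the
exponential moment of `‖X v‖²` factorizes. With independent columns it is bounded by adding one
column at a time: by `‖X_j‖ = √n` only the cross term with the previous partial sum is random, and
it is sub-Gaussian conditionally on that sum (`FoBa.IndepCols.lintegral_exp_norm_sq_sum_le`). The
vectors need not be centered; this costs a factor `2` per column, hence `2 ^ s` in total, which the
assumption `n ≥ C s log d` absorbs together with the union bound over supports and over a net of
each sparse sphere. The net has mesh only `1/2`, which suffices for a quadratic form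
(`FoBa.abs_norm_sq_sub_le_of_net`).

**Restricted strong convexity.** On the event of restricted isometry, the curvature bounds turn into
bounds for the Bregman remainder of `Q` by a second-order expansion along the segment
(`FoBa.bregman_bounds`). The upper constant `1.4 < 1.5` gives the strict inequality in the sparsity
condition.

**The algorithm.** The key estimate is `FoBa.Regular.card_le_levelBound`: if a forward step of gain
`g` is not followed by a removal, then each selected feature outside `supp βbar` carries a
coefficient with `L β_i² ≥ g`, so the number of such features is at most `L ‖β - βbar‖² / g`. This
distance is bounded by `g` again, because `g` controls the gap in `Q` between `β` and the minimizer
over the union of both feature sets. Since a round with a removal does not increase the number of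
features, the bound holds at every visit of the outer loop, and it leaves room for one more forward
step within the budget `s`, where all curvature bounds are valid. Termination follows from the
surplus `Q 0 - Q β - ∑ δ^(j)`, which is bounded, unchanged by forward steps and raised by a fixed
amount by each removal (`FoBa.runMeasure`).
-/

namespace FoBa

/-! ### Exponential moments of sub-Gaussian vectors -/

section Moments

variable {Ω : Type*} [MeasurableSpace Ω]

theorem exp_le_one_add_add_sq_mul_exp_abs (x : ℝ) :
    Real.exp x ≤ 1 + x + x ^ 2 * Real.exp |x| := by
  by_cases hx : |x| ≤ 1
  · have h := (abs_le.1 (Real.abs_exp_sub_one_sub_id_le hx)).2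
    have h1 : 1 ≤ Real.exp |x| := Real.one_le_exp (abs_nonneg x)
    nlinarith [sq_nonneg x]
  · push Not at hx
    have h1 : 1 ≤ Real.exp |x| := Real.one_le_exp (abs_nonneg x)
    have hsq : |x| ≤ x ^ 2 := by rw [← sq_abs]; nlinarith
    have h1' : |x| * 1 ≤ x ^ 2 * Real.exp |x| :=
      mul_le_mul hsq h1 zero_le_one (sq_nonneg x)
    rcases le_or_gt 0 x with h0 | h0
    · rw [abs_of_nonneg h0] at hx ⊢
      have h2 : 1 * Real.exp x ≤ x ^ 2 * Real.exp x :=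
        mul_le_mul_of_nonneg_right (by nlinarith) (Real.exp_pos x).le
      linarith
    · have h2 : Real.exp x ≤ 1 := Real.exp_le_one_iff.2 h0.le
      rw [abs_of_neg h0] at h1' ⊢
      linarith

/-- Exponential moment of a linear functional of a sub-Gaussian vector. No centering is needed, at
the price of the factor `2`. -/
theorem SubGaussianVec.lintegral_exp_inner_le {m : ℕ} {μ : Measure Ω} [IsProbabilityMeasure μ]
    {Z : Ω → Vec m} {K : ℝ} (hK : 0 < K) (hZ : SubGaussianVec μ Z K) (a : Vec m) :
    ∫⁻ ω, ENNReal.ofReal (Real.exp (inner ℝ (Z ω) a)) ∂μ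
      ≤ 2 * ENNReal.ofReal (Real.exp (K ^ 2 * ‖a‖ ^ 2 / 4)) := by
  rcases eq_or_ne a 0 with rfl | ha
  · simp
  have hn : 0 < ‖a‖ := norm_pos_iff.2 ha
  set u : Vec m := ‖a‖⁻¹ • a with hu
  have hu1 : ‖u‖ = 1 := by
    rw [hu, norm_smul, norm_inv, norm_norm, inv_mul_cancel₀ hn.ne']
  have hau : a = ‖a‖ • u := by rw [hu, smul_smul, mul_inv_cancel₀ hn.ne', one_smul]
  calc ∫⁻ ω, ENNReal.ofReal (Real.exp (inner ℝ (Z ω) a)) ∂μ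
      ≤ ∫⁻ ω, ENNReal.ofReal (Real.exp (K ^ 2 * ‖a‖ ^ 2 / 4)) *
          ENNReal.ofReal (Real.exp ((inner ℝ (Z ω) u) ^ 2 / K ^ 2)) ∂μ := by
        refine lintegral_mono fun ω => ?_
        rw [← ENNReal.ofReal_mul (Real.exp_pos _).le, ← Real.exp_add]
        refine ENNReal.ofReal_le_ofReal (Real.exp_le_exp.2 ?_)
        have h1 : inner ℝ (Z ω) a = ‖a‖ * inner ℝ (Z ω) u := by
          conv_lhs => rw [hau]
          rw [inner_smul_right]
        rw [h1]
        set w := inner ℝ (Z ω) u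
        have h2 : K ^ 2 * ‖a‖ ^ 2 / 4 + w ^ 2 / K ^ 2 - ‖a‖ * w
            = (K * ‖a‖ / 2 - w / K) ^ 2 := by
          field_simp
          ring
        nlinarith [sq_nonneg (K * ‖a‖ / 2 - w / K)]
    _ = ENNReal.ofReal (Real.exp (K ^ 2 * ‖a‖ ^ 2 / 4)) *
          ∫⁻ ω, ENNReal.ofReal (Real.exp ((inner ℝ (Z ω) u) ^ 2 / K ^ 2)) ∂μ :=
        lintegral_const_mul' _ _ ENNReal.ofReal_ne_top
    _ ≤ ENNReal.ofReal (Real.exp (K ^ 2 * ‖a‖ ^ 2 / 4)) * 2 := by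
        gcongr
        exact hZ u hu1
    _ = _ := mul_comm _ _

theorem IsotropicVec.integral_inner_sq {m : ℕ} {μ : Measure Ω} {Z : Ω → Vec m}
    (hZ : IsotropicVec μ Z) (u : Vec m) :
    Integrable (fun ω => (inner ℝ (Z ω) u) ^ 2) μ ∧
      ∫ ω, (inner ℝ (Z ω) u) ^ 2 ∂μ = ‖u‖ ^ 2 := by
  have h : ∀ ω, (inner ℝ (Z ω) u) ^ 2 = ∑ a, ∑ b, u a * u b * (Z ω a * Z ω b) := by
    intro ω
    rw [PiLp.inner_apply, sq, Finset.sum_mul_sum]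
    refine Finset.sum_congr rfl fun a _ => Finset.sum_congr rfl fun b _ => ?_
    simp only [RCLike.inner_apply, conj_trivial]
    ring
  simp_rw [h]
  have hi : ∀ a b, Integrable (fun ω => u a * u b * (Z ω a * Z ω b)) μ :=
    fun a b => (hZ a b).1.const_mul _
  refine ⟨integrable_finsetSum _ fun a _ => integrable_finsetSum _ fun b _ => hi a b, ?_⟩
  rw [integral_finsetSum _ fun a _ => integrable_finsetSum _ fun b _ => hi a b]
  simp_rw [integral_finsetSum _ fun b _ => hi _ b, integral_const_mul, (hZ _ _).2]
  rw [EuclideanSpace.norm_sq_eq]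
  simp [sq]

/-- Exponential moments, of either sign, of the square of a linear functional of an isotropic
sub-Gaussian vector. -/
theorem lintegral_exp_inner_sq_le {m : ℕ} {μ : Measure Ω} [IsProbabilityMeasure μ]
    {Z : Ω → Vec m} {K : ℝ} (hK : 0 < K) (hmeas : Measurable Z) (hI : IsotropicVec μ Z)
    (hZ : SubGaussianVec μ Z K) {u : Vec m} (hu : ‖u‖ = 1) {t : ℝ} (ht : |t| * K ^ 2 ≤ 1 / 2) :
    ∫⁻ ω, ENNReal.ofReal (Real.exp (t * (inner ℝ (Z ω) u) ^ 2)) ∂μ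
      ≤ ENNReal.ofReal (Real.exp (t + 16 * K ^ 4 * t ^ 2)) := by
  set W : Ω → ℝ := fun ω => (inner ℝ (Z ω) u) ^ 2 with hW
  have hWm : Measurable W := by
    have : Measurable fun ω => inner ℝ (Z ω) u := hmeas.inner measurable_const
    exact this.pow_const 2
  have hW0 : ∀ ω, 0 ≤ W ω := fun ω => sq_nonneg _
  obtain ⟨hWi, hW1⟩ := hI.integral_inner_sq u
  have hE : Integrable (fun ω => Real.exp (W ω / K ^ 2)) μ := by
    refine ⟨(hWm.div_const _).exp.aestronglyMeasurable, ?_⟩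
    rw [hasFiniteIntegral_iff_ofReal (Filter.Eventually.of_forall fun ω => (Real.exp_pos _).le)]
    exact (hZ u hu).trans_lt (by simp)
  have hE2 : ∫ ω, Real.exp (W ω / K ^ 2) ∂μ ≤ 2 := by
    rw [integral_eq_lintegral_of_nonneg_ae (Filter.Eventually.of_forall fun ω => (Real.exp_pos _).le)
      hE.aestronglyMeasurable]
    exact ENNReal.toReal_le_of_le_ofReal (by norm_num) (by simpa using hZ u hu)
  have hK2 : 0 < K ^ 2 := by positivity
  have key : ∀ ω, Real.exp (t * W ω)
      ≤ 1 + t * W ω + 8 * K ^ 4 * t ^ 2 * Real.exp (W ω / K ^ 2) := by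
    intro ω
    refine (exp_le_one_add_add_sq_mul_exp_abs _).trans ?_
    set x := W ω / (2 * K ^ 2) with hx
    have hx0 : 0 ≤ x := by have := hW0 ω; positivity
    have hWx : W ω = 2 * K ^ 2 * x := by rw [hx]; field_simp
    have h1 : x ^ 2 ≤ 2 * Real.exp x := by
      have := Real.quadratic_le_exp_of_nonneg hx0
      nlinarith
    have h2 : |t * W ω| ≤ x := by
      rw [abs_mul, abs_of_nonneg (hW0 ω), hWx]
      nlinarith
    have h3 : Real.exp |t * W ω| ≤ Real.exp x := Real.exp_le_exp.2 h2
    have h4 : Real.exp (W ω / K ^ 2) = Real.exp x * Real.exp x := by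
      rw [← Real.exp_add, hWx]; congr 1; field_simp; ring
    have h5 : (t * W ω) ^ 2 = 4 * K ^ 4 * t ^ 2 * x ^ 2 := by rw [hWx]; ring
    have h6 : x ^ 2 * Real.exp |t * W ω| ≤ 2 * Real.exp x * Real.exp x := by
      have := Real.exp_pos |t * W ω|
      gcongr
    rw [h4, h5]
    have h7 : 0 ≤ 4 * K ^ 4 * t ^ 2 := by positivity
    nlinarith [mul_le_mul_of_nonneg_left h6 h7]
  have hi1 : Integrable (fun ω => 1 + t * W ω) μ := (integrable_const _).add (hWi.const_mul t)
  have hi2 : Integrable (fun ω => 8 * K ^ 4 * t ^ 2 * Real.exp (W ω / K ^ 2)) μ := hE.const_mul _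
  have hpos : ∀ ω, 0 ≤ 1 + t * W ω + 8 * K ^ 4 * t ^ 2 * Real.exp (W ω / K ^ 2) :=
    fun ω => (Real.exp_pos _).le.trans (key ω)
  calc ∫⁻ ω, ENNReal.ofReal (Real.exp (t * W ω)) ∂μ
      ≤ ∫⁻ ω, ENNReal.ofReal (1 + t * W ω + 8 * K ^ 4 * t ^ 2 * Real.exp (W ω / K ^ 2)) ∂μ :=
        lintegral_mono fun ω => ENNReal.ofReal_le_ofReal (key ω)
    _ = ENNReal.ofReal (∫ ω, (1 + t * W ω + 8 * K ^ 4 * t ^ 2 * Real.exp (W ω / K ^ 2)) ∂μ) :=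
        (ofReal_integral_eq_lintegral_ofReal (hi1.add hi2)
          (Filter.Eventually.of_forall hpos)).symm
    _ ≤ _ := by
        refine ENNReal.ofReal_le_ofReal ?_
        rw [integral_add hi1 hi2, integral_add (integrable_const _) (hWi.const_mul t),
          integral_const_mul, integral_const_mul, hW1, hu]
        have h8 : 0 ≤ 8 * K ^ 4 * t ^ 2 := by positivity
        have h9 := mul_le_mul_of_nonneg_left hE2 h8
        have h10 := Real.add_one_le_exp (t + 16 * K ^ 4 * t ^ 2)
        simp only [integral_const, probReal_univ, smul_eq_mul]
        linarith

end Moments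

/-! ### Concentration of the norm of `X v` at a fixed vector `v` -/

section Concentration

theorem inner_rowVec {Ω : Type*} {n d : ℕ} (X : Ω → Matrix (Fin n) (Fin d) ℝ) (i : Fin n) (ω : Ω)
    (v : Vec d) :
    inner ℝ (rowVec X i ω) v = (X ω).mulVec v.ofLp i := by
  simp [rowVec, PiLp.inner_apply, Matrix.mulVec, dotProduct, mul_comm]

theorem sum_mulVec_sq_eq_norm_sq_sum_colVec {Ω : Type*} {n d : ℕ}
    (X : Ω → Matrix (Fin n) (Fin d) ℝ) (ω : Ω) {v : Vec d} {T : Finset (Fin d)} (hT : supp v ⊆ T) :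
    ∑ i, ((X ω).mulVec v.ofLp i) ^ 2 = ‖∑ j ∈ T, v j • colVec X j ω‖ ^ 2 := by
  rw [EuclideanSpace.norm_sq_eq]
  refine Finset.sum_congr rfl fun i _ => ?_
  rw [Real.norm_eq_abs, sq_abs]
  congr 1
  have h0 : ∀ j, j ∉ T → v j = 0 := fun j hj => by
    by_contra h
    exact hj (hT (by simp [supp, h]))
  simp only [colVec, WithLp.ofLp_sum, WithLp.ofLp_smul, Finset.sum_apply, Pi.smul_apply,
    smul_eq_mul, Matrix.mulVec, dotProduct]
  rw [← Finset.sum_subset (Finset.subset_univ T) fun j _ hj => by simp [h0 j hj]]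
  exact Finset.sum_congr rfl fun j _ => mul_comm _ _

variable {Ω : Type*} [MeasurableSpace Ω] {n d : ℕ}

/-- The normalized squared norm `‖X v‖² / n`. -/
noncomputable def gramForm (X : Matrix (Fin n) (Fin d) ℝ) (v : Vec d) : ℝ :=
  (1 / (n : ℝ)) * ∑ i, (X.mulVec v.ofLp i) ^ 2

/-- Chernoff's bound in the form used below, for both tails of a nonnegative quantity of size
about `n`. -/
theorem measure_abs_sub_one_gt_le {μ : Measure Ω} {S : Ω → ℝ} {A : ℝ≥0∞} {t τ B : ℝ}
    (ht : 0 ≤ t) (hn : 0 < n)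
    (hplus : ∫⁻ ω, ENNReal.ofReal (Real.exp (t * S ω)) ∂μ
      ≤ A * ENNReal.ofReal (Real.exp (n * (t + B))))
    (hminus : ∫⁻ ω, ENNReal.ofReal (Real.exp (-t * S ω)) ∂μ
      ≤ A * ENNReal.ofReal (Real.exp (n * (-t + B)))) (hS : AEMeasurable S μ) :
    μ {ω | τ < |(1 / (n : ℝ)) * S ω - 1|}
      ≤ 2 * (A * ENNReal.ofReal (Real.exp (-(t * τ - B) * n))) := by
  have hn' : (0 : ℝ) < n := by exact_mod_cast hn
  -- One tail: for `σ = ±1` apply Markov's inequality to `exp (σ t S)`.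
  have tail : ∀ σ : ℝ, σ * σ = 1 →
      ∫⁻ ω, ENNReal.ofReal (Real.exp (σ * t * S ω)) ∂μ
        ≤ A * ENNReal.ofReal (Real.exp (n * (σ * t + B))) →
      μ {ω | τ < σ * ((1 / (n : ℝ)) * S ω - 1)}
        ≤ A * ENNReal.ofReal (Real.exp (-(t * τ - B) * n)) := by
    intro σ hσ h
    set c : ℝ := Real.exp (n * t * (τ + σ)) with hc
    have hc0 : 0 < c := Real.exp_pos _
    have hsub : {ω | τ < σ * ((1 / (n : ℝ)) * S ω - 1)}
        ⊆ {ω | ENNReal.ofReal c ≤ ENNReal.ofReal (Real.exp (σ * t * S ω))} := by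
      intro ω hω
      refine ENNReal.ofReal_le_ofReal (Real.exp_le_exp.2 ?_)
      have h1 : τ * n < σ * S ω - σ * n := by
        have := mul_lt_mul_of_pos_right (Set.mem_ofPred_eq ▸ hω) hn'
        have h2 : σ * ((1 / (n : ℝ)) * S ω - 1) * n = σ * S ω - σ * n := by field_simp
        linarith
      nlinarith
    have hm : AEMeasurable (fun ω => ENNReal.ofReal (Real.exp (σ * t * S ω))) μ :=
      (Real.measurable_exp.comp_aemeasurable (hS.const_mul _)).ennreal_ofReal
    refine (measure_mono hsub).trans ?_
    refine (meas_ge_le_lintegral_div hm (by simpa using hc0) ENNReal.ofReal_ne_top).trans ?_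
    refine (ENNReal.div_le_div_right h _).trans (le_of_eq ?_)
    rw [mul_div_assoc, ← ENNReal.ofReal_div_of_pos hc0, hc, ← Real.exp_sub]
    congr 3
    ring
  have hcov : {ω | τ < |(1 / (n : ℝ)) * S ω - 1|}
      ⊆ {ω | τ < 1 * ((1 / (n : ℝ)) * S ω - 1)} ∪ {ω | τ < (-1) * ((1 / (n : ℝ)) * S ω - 1)} := by
    intro ω hω
    rcases lt_abs.1 (Set.mem_ofPred_eq ▸ hω) with h | h
    · left; simpa using h
    · right; simpa using h
  refine (measure_mono hcov).trans ((measure_union_le _ _).trans ?_)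
  rw [two_mul]
  exact add_le_add (tail 1 (by norm_num) (by simpa using hplus))
    (tail (-1) (by norm_num) (by simpa using hminus))

theorem IndepRows.lintegral_exp_sum_sq_le {μ : Measure Ω} [IsProbabilityMeasure μ]
    {X : Ω → Matrix (Fin n) (Fin d) ℝ} {K : ℝ} (hK : 0 < K) (hX : IndepRows μ X K)
    {v : Vec d} (hv : ‖v‖ = 1) {t : ℝ} (ht : |t| * K ^ 2 ≤ 1 / 2) :
    ∫⁻ ω, ENNReal.ofReal (Real.exp (t * ∑ i, ((X ω).mulVec v.ofLp i) ^ 2)) ∂μ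
      ≤ ENNReal.ofReal (Real.exp (n * (t + 16 * K ^ 4 * t ^ 2))) := by
  set g : Vec d → ℝ≥0∞ := fun z => ENNReal.ofReal (Real.exp (t * (inner ℝ z v) ^ 2)) with hg
  have hgm : Measurable g := by
    have : Measurable fun z : Vec d => inner ℝ z v := measurable_id.inner measurable_const
    exact ((this.pow_const 2).const_mul t).exp.ennreal_ofReal
  have h1 : ∀ ω, ENNReal.ofReal (Real.exp (t * ∑ i, ((X ω).mulVec v.ofLp i) ^ 2))
      = ∏ i, g (rowVec X i ω) := by
    intro ω
    rw [hg, Finset.mul_sum, Real.exp_sum, ENNReal.ofReal_prod_of_nonneg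
      fun i _ => (Real.exp_pos _).le]
    simp only [inner_rowVec]
  simp_rw [h1]
  have hind : iIndepFun (fun i ω => g (rowVec X i ω)) μ :=
    hX.indep.comp (fun _ => g) fun _ => hgm
  rw [lintegral_prod_eq_prod_lintegral_of_indepFun Finset.univ _ hind
    fun i => hgm.comp (hX.meas i)]
  calc ∏ i, ∫⁻ ω, g (rowVec X i ω) ∂μ
      ≤ ∏ _i : Fin n, ENNReal.ofReal (Real.exp (t + 16 * K ^ 4 * t ^ 2)) :=
        Finset.prod_le_prod' fun i _ =>
          lintegral_exp_inner_sq_le hK (hX.meas i) (hX.isotropic i) (hX.subGaussian i) hv ht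
    _ = _ := by
        rw [Finset.prod_const, Finset.card_univ, Fintype.card_fin,
          ← ENNReal.ofReal_pow (Real.exp_pos _).le, ← Real.exp_nat_mul]

/-- Exponential moments of `‖∑ j ∈ T, v j • X j‖²` for independent sub-Gaussian vectors `X j` of
norm `√n`, by adding one column at a time: conditionally on the partial sum `S`, the cross term
`2 v j ⟪S, X j⟫` is sub-Gaussian with variance proxy of order `(v j)² ‖S‖²`, which is absorbed by
a slight increase of the parameter `t`. The factor `2` lost in each step is harmless because the
number of columns is small compared with `n`. -/
theorem IndepCols.lintegral_exp_norm_sq_sum_le {μ : Measure Ω} [IsProbabilityMeasure μ]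
    {X : Ω → Matrix (Fin n) (Fin d) ℝ} {K : ℝ} (hK : 0 < K) (hX : IndepCols μ X K)
    (v : Fin d → ℝ) (T : Finset (Fin d)) :
    ∀ t : ℝ, |t| * K ^ 2 * ∑ j ∈ T, v j ^ 2 ≤ 1 / 2 →
      ∫⁻ ω, ENNReal.ofReal (Real.exp (t * ‖∑ j ∈ T, v j • colVec X j ω‖ ^ 2)) ∂μ
        ≤ 2 ^ T.card * ENNReal.ofReal (Real.exp
          (n * (t * ∑ j ∈ T, v j ^ 2 + 2 * t ^ 2 * K ^ 2 * (∑ j ∈ T, v j ^ 2) ^ 2))) := by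
  induction T using Finset.induction_on with
  | empty => intro t _; simp
  | insert j T hj ih =>
    intro t ht
    rw [Finset.sum_insert hj] at ht ⊢
    set V := ∑ j ∈ T, v j ^ 2 with hV
    have hV0 : 0 ≤ V := Finset.sum_nonneg fun _ _ => sq_nonneg _
    have hK2 : 0 < K ^ 2 := by positivity
    have hm : ∀ j, Measurable fun ω => v j • colVec X j ω := fun j => (hX.meas j).fun_const_smul (v j)
    set S : Ω → Vec n := fun ω => ∑ j ∈ T, v j • colVec X j ω with hS
    set Z : Ω → Vec n := fun ω => v j • colVec X j ω with hZ
    have hSm : Measurable S := Finset.measurable_sum _ fun i _ => hm i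
    have hind : IndepFun S Z μ := by
      have h1 : iIndepFun (fun i ω => v i • colVec X i ω) μ :=
        hX.indep.comp (fun i (z : Vec n) => v i • z) fun i => measurable_const_smul _
      have h2 := h1.indepFun_finsetSum_of_notMem hm hj
      convert h2 using 1
      ext1 ω
      simp [hS]
    have hprod := (indepFun_iff_map_prod_eq_prod_map_map hSm.aemeasurable (hm j).aemeasurable).1 hind
    set F : Vec n × Vec n → ℝ≥0∞ := fun p =>
      ENNReal.ofReal (Real.exp (t * ‖p.1‖ ^ 2 + 2 * t * inner ℝ p.2 p.1)) with hF
    have hFm : Measurable F := by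
      have h1 : Measurable fun p : Vec n × Vec n => ‖p.1‖ ^ 2 := (measurable_fst.norm).pow_const 2
      have h2 : Measurable fun p : Vec n × Vec n => inner ℝ p.2 p.1 :=
        measurable_snd.inner measurable_fst
      exact ((h1.const_mul t).add (h2.const_mul (2 * t))).exp.ennreal_ofReal
    set t' : ℝ := t + t ^ 2 * K ^ 2 * v j ^ 2 with ht'
    -- Integrating over the new column with the partial sum frozen.
    have hstep : ∫⁻ ω, F (S ω, Z ω) ∂μ
        ≤ 2 * ∫⁻ ω, ENNReal.ofReal (Real.exp (t' * ‖S ω‖ ^ 2)) ∂μ := by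
      have h1 : ∫⁻ ω, F (S ω, Z ω) ∂μ = ∫⁻ a, ∫⁻ z, F (a, z) ∂(μ.map Z) ∂(μ.map S) := by
        rw [← lintegral_prod _ hFm.aemeasurable, ← hprod,
          lintegral_map hFm (hSm.prodMk (hm j))]
      rw [h1, ← lintegral_const_mul' _ _ (by simp), ← lintegral_map (μ := μ) (g := S)
        (f := fun a => 2 * ENNReal.ofReal (Real.exp (t' * ‖a‖ ^ 2))) (by fun_prop) hSm]
      refine lintegral_mono fun a => ?_
      simp only
      have hFa : Measurable fun z => F (a, z) := hFm.comp measurable_prodMk_left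
      rw [lintegral_map hFa (hm j)]
      have h2 : ∀ ω, F (a, Z ω) = ENNReal.ofReal (Real.exp (t * ‖a‖ ^ 2)) *
          ENNReal.ofReal (Real.exp (inner ℝ (colVec X j ω) ((2 * t * v j) • a))) := by
        intro ω
        rw [hF, hZ, ← ENNReal.ofReal_mul (Real.exp_pos _).le, ← Real.exp_add]
        simp only [inner_smul_left, inner_smul_right, conj_trivial]
        congr 3
        ring
      refine (lintegral_congr h2).trans_le ?_
      rw [lintegral_const_mul' _ _ ENNReal.ofReal_ne_top]
      refine (mul_le_mul_right ((hX.subGaussian j).lintegral_exp_inner_le hK _) _).trans ?_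
      rw [mul_left_comm, ← ENNReal.ofReal_mul (Real.exp_pos _).le, ← Real.exp_add, norm_smul,
        Real.norm_eq_abs, mul_pow, sq_abs]
      refine mul_le_mul_right (ENNReal.ofReal_le_ofReal (Real.exp_le_exp.2 (le_of_eq ?_))) _
      rw [ht']; ring
    have hae : ∀ᵐ ω ∂μ, ENNReal.ofReal
          (Real.exp (t * ‖∑ j ∈ insert j T, v j • colVec X j ω‖ ^ 2))
        = ENNReal.ofReal (Real.exp (t * (v j ^ 2 * n))) * F (S ω, Z ω) := by
      filter_upwards [hX.norm_eq j] with ω hω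
      rw [Finset.sum_insert hj, hF, ← ENNReal.ofReal_mul (Real.exp_pos _).le, ← Real.exp_add]
      congr 2
      change t * ‖Z ω + S ω‖ ^ 2 = _
      have hZn : ‖Z ω‖ ^ 2 = v j ^ 2 * n := by
        rw [hZ]
        simp only
        rw [norm_smul, hω, mul_pow, Real.norm_eq_abs, sq_abs, Real.sq_sqrt (Nat.cast_nonneg n)]
      rw [norm_add_sq_real, hZn]
      ring
    rw [lintegral_congr_ae hae, lintegral_const_mul' _ _ ENNReal.ofReal_ne_top]
    have hx0 : 0 ≤ v j ^ 2 := sq_nonneg _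
    have habs : 0 ≤ |t| := abs_nonneg t
    have hsq : t ^ 2 = |t| ^ 2 := (sq_abs t).symm
    have htV : |t| * K ^ 2 * V ≤ 1 / 2 := by
      have : 0 ≤ |t| * K ^ 2 * v j ^ 2 := by positivity
      linarith
    have htx : |t| * K ^ 2 * v j ^ 2 ≤ 1 / 2 := by
      have : 0 ≤ |t| * K ^ 2 * V := by positivity
      linarith
    have ht'abs : |t'| ≤ |t| * (1 + |t| * K ^ 2 * v j ^ 2) := by
      rw [ht']
      refine (abs_add_le _ _).trans (le_of_eq ?_)
      rw [abs_of_nonneg (by positivity : 0 ≤ t ^ 2 * K ^ 2 * v j ^ 2), hsq]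
      ring
    have ih' := ih t' (by
      have h1 : |t'| * (K ^ 2 * V) ≤ |t| * (1 + |t| * K ^ 2 * v j ^ 2) * (K ^ 2 * V) := by
        gcongr
      have h2 : |t| * K ^ 2 * v j ^ 2 * (|t| * K ^ 2 * V) ≤ |t| * K ^ 2 * v j ^ 2 * (1 / 2) := by
        gcongr
      have h3 : 0 ≤ |t| * K ^ 2 * v j ^ 2 := by positivity
      nlinarith)
    refine (mul_le_mul_right (hstep.trans (mul_le_mul_right ih' _)) _).trans ?_
    rw [Finset.card_insert_of_notMem hj, pow_succ' (2 : ℝ≥0∞), mul_left_comm,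
      mul_left_comm (ENNReal.ofReal _), ← mul_assoc,
      ← ENNReal.ofReal_mul (Real.exp_pos _).le, ← Real.exp_add]
    refine mul_le_mul_right (ENNReal.ofReal_le_ofReal (Real.exp_le_exp.2 ?_)) _
    have hn0 : (0 : ℝ) ≤ n := Nat.cast_nonneg n
    have hkey : t * v j ^ 2 + (t' * V + 2 * t' ^ 2 * K ^ 2 * V ^ 2)
        ≤ t * (v j ^ 2 + V) + 2 * t ^ 2 * K ^ 2 * (v j ^ 2 + V) ^ 2 := by
      set x := v j ^ 2
      set a := |t| * K ^ 2 * x with ha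
      set b := |t| * K ^ 2 * V with hb
      have ha0 : 0 ≤ a := by positivity
      have hb0 : 0 ≤ b := by positivity
      have h1 : t' ^ 2 ≤ t ^ 2 * (1 + a) ^ 2 := by
        rw [← sq_abs t', hsq, ← mul_pow]
        gcongr
      have h2 : 2 * t' ^ 2 * K ^ 2 * V ^ 2 ≤ 2 * (t ^ 2 * (1 + a) ^ 2) * K ^ 2 * V ^ 2 := by
        gcongr
      -- In terms of `a` and `b` the claim reads `b a + 2 (1 + a)² b² ≤ 2 (a + b)²`.
      have h3 : b * a + 2 * (1 + a) ^ 2 * b ^ 2 ≤ 2 * (a + b) ^ 2 := by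
        have h4 : a * b * b ≤ a * b * (1 / 2) := by gcongr
        have h5 : (a * b) ^ 2 ≤ (a * (1 / 2)) ^ 2 := by gcongr
        nlinarith
      have h6 : t ^ 2 * K ^ 2 * x * V * K ^ 2 = b * a := by rw [hsq, ha, hb]; ring
      have h7 : 2 * (t ^ 2 * (1 + a) ^ 2) * K ^ 2 * V ^ 2 * K ^ 2 = 2 * (1 + a) ^ 2 * b ^ 2 := by
        rw [hsq, hb]; ring
      have h8 : 2 * t ^ 2 * K ^ 2 * (x + V) ^ 2 * K ^ 2 = 2 * (a + b) ^ 2 := by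
        rw [hsq, ha, hb]; ring
      have h9 : t ^ 2 * K ^ 2 * x * V + 2 * (t ^ 2 * (1 + a) ^ 2) * K ^ 2 * V ^ 2
          ≤ 2 * t ^ 2 * K ^ 2 * (x + V) ^ 2 := by
        refine le_of_mul_le_mul_right ?_ hK2
        rw [add_mul, h6, h7, h8]
        exact h3
      have h10 : t' * V = t * V + t ^ 2 * K ^ 2 * x * V := by rw [ht']; ring
      linarith
    nlinarith [mul_le_mul_of_nonneg_left hkey hn0]

/-- At a fixed unit vector supported in `T`, the quantity `‖X v‖² / n` deviates from `1` by more
than `τ ≤ 1` with exponentially small probability, in both models for `X`. -/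
theorem measure_gramForm_deviation_le {K : ℝ} (hK : 0 < K) {τ : ℝ} (hτ : 0 < τ) (hτ1 : τ ≤ 1) :
    ∃ c : ℝ, 0 < c ∧ ∀ {Ω : Type*} [MeasurableSpace Ω] (μ : Measure Ω) [IsProbabilityMeasure μ]
      (n d : ℕ) (X : Ω → Matrix (Fin n) (Fin d) ℝ), 0 < n → IndepRows μ X K ∨ IndepCols μ X K →
      ∀ (v : Vec d) (T : Finset (Fin d)), ‖v‖ = 1 → supp v ⊆ T →
        μ {ω | τ < |gramForm (X ω) v - 1|}
          ≤ 2 * (2 ^ T.card * ENNReal.ofReal (Real.exp (-c * n))) := by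
  set t₁ : ℝ := min (1 / (2 * K ^ 2)) (τ / (32 * K ^ 4)) with ht₁
  have ht₁0 : 0 < t₁ := lt_min (by positivity) (by positivity)
  refine ⟨min (t₁ * τ / 2) (τ ^ 2 / (8 * K ^ 2)), lt_min (by positivity) (by positivity), ?_⟩
  intro Ω _ μ _ n d X hn hX v T hv hT
  have hn' : (0 : ℝ) < n := by exact_mod_cast hn
  suffices h : ∃ t B : ℝ, 0 ≤ t ∧ min (t₁ * τ / 2) (τ ^ 2 / (8 * K ^ 2)) ≤ t * τ - B ∧
      AEMeasurable (fun ω => ∑ i, ((X ω).mulVec v.ofLp i) ^ 2) μ ∧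
      ∀ σ : ℝ, |σ| = 1 →
        ∫⁻ ω, ENNReal.ofReal (Real.exp (σ * t * ∑ i, ((X ω).mulVec v.ofLp i) ^ 2)) ∂μ
          ≤ 2 ^ T.card * ENNReal.ofReal (Real.exp (n * (σ * t + B))) by
    obtain ⟨t, B, ht, hc, hS, h⟩ := h
    refine (measure_abs_sub_one_gt_le ht hn (by simpa using h 1 (by simp))
      (by simpa using h (-1) (by simp)) hS).trans ?_
    gcongr
  rcases hX with hX | hX
  · refine ⟨t₁, 16 * K ^ 4 * t₁ ^ 2, ht₁0.le, (min_le_left _ _).trans ?_, ?_, fun σ hσ => ?_⟩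
    · have h1 : t₁ * (32 * K ^ 4) ≤ τ :=
        (le_div_iff₀ (by positivity)).1 (min_le_right _ _)
      nlinarith
    · simp_rw [← inner_rowVec]
      exact (Finset.measurable_sum _ fun i _ =>
        ((hX.meas i).inner measurable_const).pow_const 2).aemeasurable
    · have h1 : t₁ * (2 * K ^ 2) ≤ 1 := (le_div_iff₀ (by positivity)).1 (min_le_left _ _)
      have habs : |σ * t₁| = t₁ := by rw [abs_mul, hσ, one_mul, abs_of_pos ht₁0]
      have hsq : (σ * t₁) ^ 2 = t₁ ^ 2 := by rw [mul_pow, ← sq_abs σ, hσ]; ring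
      have h2 := hX.lintegral_exp_sum_sq_le hK hv (t := σ * t₁) (by rw [habs]; linarith)
      rw [hsq] at h2
      exact h2.trans (le_mul_of_one_le_left' (one_le_pow₀ one_le_two))
  · have hV : ∑ j ∈ T, v j ^ 2 = 1 := by
      have h1 : ∑ j, v j ^ 2 = 1 := by
        have := EuclideanSpace.norm_sq_eq v
        simpa [hv] using this.symm
      rw [← h1]
      refine Finset.sum_subset (Finset.subset_univ T) fun j _ hj => ?_
      have : v j = 0 := by
        by_contra h
        exact hj (hT (by simp [supp, h]))
      simp [this]
    have ht0 : 0 < τ / (4 * K ^ 2) := by positivity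
    have hrw := fun ω => sum_mulVec_sq_eq_norm_sq_sum_colVec X ω hT
    refine ⟨τ / (4 * K ^ 2), 2 * (τ / (4 * K ^ 2)) ^ 2 * K ^ 2, ht0.le,
      (min_le_right _ _).trans (le_of_eq ?_), ?_, fun σ hσ => ?_⟩
    · field_simp
      ring
    · simp_rw [hrw]
      exact ((Finset.measurable_sum _ fun j _ =>
        (hX.meas j).fun_const_smul (v j)).norm.pow_const 2).aemeasurable
    · have habs : |σ * (τ / (4 * K ^ 2))| = τ / (4 * K ^ 2) := by
        rw [abs_mul, hσ, one_mul, abs_of_pos ht0]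
      have hsq : (σ * (τ / (4 * K ^ 2))) ^ 2 = (τ / (4 * K ^ 2)) ^ 2 := by
        rw [mul_pow, ← sq_abs σ, hσ]; ring
      have h2 := hX.lintegral_exp_norm_sq_sum_le hK v T (σ * (τ / (4 * K ^ 2))) (by
        rw [habs, hV]
        have : τ / (4 * K ^ 2) * K ^ 2 = τ / 4 := by field_simp
        rw [this]; linarith)
      rw [hV, hsq] at h2
      simp_rw [hrw]
      simpa using h2

end Concentration

/-! ### From a net of the sphere to all sparse vectors -/

/-- A `1/2`-net of the unit sphere with at most `5 ^ k` points. -/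
theorem exists_half_net_sphere (k : ℕ) :
    ∃ N : Finset (Vec k), N.card ≤ 5 ^ k ∧ (∀ y ∈ N, ‖y‖ = 1) ∧
      ∀ x : Vec k, ‖x‖ = 1 → ∃ y ∈ N, ‖x - y‖ ≤ 1 / 2 := by
  classical
  set P : ℕ → Prop := fun m => ∃ N : Finset (Vec k), N.card = m ∧ (∀ y ∈ N, ‖y‖ = 1) ∧
    ∀ x ∈ N, ∀ y ∈ N, x ≠ y → 1 / 2 ≤ ‖x - y‖ with hP
  -- The packing bound is applied to the set scaled by `2`.
  have hbound : ∀ m, P m → m ≤ 5 ^ k := by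
    rintro m ⟨N, rfl, h1, h2⟩
    have hinj : Function.Injective fun y : Vec k => (2 : ℝ) • y :=
      smul_right_injective _ two_ne_zero
    have h := Besicovitch.card_le_of_separated (N.image fun y => (2 : ℝ) • y) (by
        intro c hc
        obtain ⟨y, hy, rfl⟩ := Finset.mem_image.1 hc
        rw [norm_smul, h1 y hy]; norm_num) (by
        intro c hc e he hce
        obtain ⟨y, hy, rfl⟩ := Finset.mem_image.1 hc
        obtain ⟨z, hz, rfl⟩ := Finset.mem_image.1 he
        have h3 := h2 y hy z hz (fun h => hce (by rw [h]))
        rw [← smul_sub, norm_smul]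
        norm_num
        linarith)
    rwa [Finset.card_image_of_injective _ hinj, finrank_euclideanSpace, Fintype.card_fin] at h
  have h0 : P 0 := ⟨∅, by simp⟩
  obtain ⟨N, hN, h1, h2⟩ : P (Nat.findGreatest P (5 ^ k)) :=
    Nat.findGreatest_spec (Nat.zero_le _) h0
  refine ⟨N, hN ▸ Nat.findGreatest_le _, h1, fun x hx => ?_⟩
  by_contra! hcon
  have hxN : x ∉ N := fun h => by
    have := hcon x h
    simp at this
    linarith
  have hP' : P (N.card + 1) := by
    refine ⟨insert x N, Finset.card_insert_of_notMem hxN, ?_, ?_⟩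
    · intro y hy
      rcases Finset.mem_insert.1 hy with rfl | hy
      exacts [hx, h1 y hy]
    · intro y hy z hz hyz
      rcases Finset.mem_insert.1 hy with hy' | hy' <;> rcases Finset.mem_insert.1 hz with hz' | hz'
      · exact absurd (hy'.trans hz'.symm) hyz
      · rw [hy']; exact (hcon z hz').le
      · rw [hz', norm_sub_rev]; exact (hcon y hy').le
      · exact h2 y hy' z hz' hyz
  have := Nat.le_findGreatest (hbound _ hP') hP'
  omega

/-- A quadratic form of the shape `‖G v‖² - ‖v‖²` that is at most `τ` in absolute value on a
`1/2`-net of the unit sphere is at most `32 τ` on the unit sphere. -/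
theorem abs_norm_sq_sub_le_of_net {k : ℕ} {F : Type*} [NormedAddCommGroup F]
    [InnerProductSpace ℝ F] (G : Vec k →L[ℝ] F) {N : Finset (Vec k)} {τ : ℝ}
    (hnet : ∀ x : Vec k, ‖x‖ = 1 → ∃ y ∈ N, ‖x - y‖ ≤ 1 / 2) (hN : ∀ y ∈ N, ‖y‖ = 1)
    (hτ : ∀ y ∈ N, |‖G y‖ ^ 2 - ‖y‖ ^ 2| ≤ τ) (v : Vec k) :
    |‖G v‖ ^ 2 - ‖v‖ ^ 2| ≤ 32 * τ * ‖v‖ ^ 2 := by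
  set p : Vec k → ℝ := fun v => ‖G v‖ ^ 2 - ‖v‖ ^ 2 with hp
  have hscale : ∀ (c : ℝ) (w : Vec k), p (c • w) = c ^ 2 * p w := by
    intro c w
    simp only [hp, map_smul, norm_smul, mul_pow, Real.norm_eq_abs, sq_abs]
    ring
  rcases eq_or_ne v 0 with rfl | hv
  · simp
  have hvn : 0 < ‖v‖ := norm_pos_iff.2 hv
  have hunit : ‖‖v‖⁻¹ • v‖ = 1 := by rw [norm_smul, norm_inv, norm_norm, inv_mul_cancel₀ hvn.ne']
  have hpc : Continuous fun x => |p x| := by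
    simp only [hp]
    fun_prop
  obtain ⟨x, hx, hmax⟩ := (isCompact_sphere (0 : Vec k) 1).exists_isMaxOn
    ⟨‖v‖⁻¹ • v, by simpa using hunit⟩ hpc.continuousOn
  have hx1 : ‖x‖ = 1 := by simpa using hx
  set M := |p x| with hM
  have hall : ∀ w, |p w| ≤ M * ‖w‖ ^ 2 := by
    intro w
    rcases eq_or_ne w 0 with rfl | hw
    · simp [hp]
    have hwn : 0 < ‖w‖ := norm_pos_iff.2 hw
    have h1 : |p (‖w‖⁻¹ • w)| ≤ M := hmax (by
      simp [norm_smul, inv_mul_cancel₀ hwn.ne'])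
    rw [hscale, abs_mul, abs_of_nonneg (sq_nonneg _), inv_pow, inv_mul_le_iff₀ (by positivity)] at h1
    linarith
  obtain ⟨y, hy, hxy⟩ := hnet x hx1
  have hy1 := hN y hy
  have hM0 : 0 ≤ M := abs_nonneg _
  -- Polarization with the orthogonal vectors `x + y` and `4 (x - y)`.
  have hpol : p x - p y = (p (x + y + (4 : ℝ) • (x - y)) - p (x + y - (4 : ℝ) • (x - y))) / 16 := by
    simp only [hp, map_add, map_sub, map_smul, ← real_inner_self_eq_norm_sq, inner_add_left,
      inner_add_right, inner_sub_left, inner_sub_right, inner_smul_left, inner_smul_right,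
      conj_trivial, real_inner_comm (G x) (G y), real_inner_comm x y]
    ring
  have hpar : ‖x + y + (4 : ℝ) • (x - y)‖ ^ 2 + ‖x + y - (4 : ℝ) • (x - y)‖ ^ 2
      = 2 * (‖x + y‖ ^ 2 + 16 * ‖x - y‖ ^ 2) := by
    have h := parallelogram_law_with_norm ℝ (x + y) ((4 : ℝ) • (x - y))
    rw [norm_smul] at h
    norm_num at h
    nlinarith
  have hsum : ‖x + y‖ ^ 2 + ‖x - y‖ ^ 2 = 4 := by
    have h := parallelogram_law_with_norm ℝ x y
    rw [hx1, hy1] at h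
    nlinarith
  have hr : ‖x - y‖ ^ 2 ≤ 1 / 4 := by nlinarith [norm_nonneg (x - y)]
  have hdiff : |p x - p y| ≤ 31 / 32 * M := by
    rw [hpol, abs_div, abs_of_pos (by norm_num : (0 : ℝ) < 16), div_le_iff₀ (by norm_num)]
    refine (abs_sub _ _).trans ?_
    refine (add_le_add (hall _) (hall _)).trans ?_
    rw [← mul_add, hpar]
    nlinarith
  have h1 : M ≤ |p x - p y| + |p y| := by
    have := abs_add_le (p x - p y) (p y)
    rwa [sub_add_cancel] at this
  have h2 : M ≤ 32 * τ := by
    have := hτ y hy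
    simp only [hp] at h1 hdiff ⊢
    linarith
  exact (hall v).trans (by gcongr)

/-- The vector with entry `w i` at the coordinate `f i` (for injective `f`) and zeros
elsewhere. -/
noncomputable def spread {k d : ℕ} (f : Fin k → Fin d) : Vec k →ₗ[ℝ] Vec d where
  toFun w := ∑ i, w i • EuclideanSpace.single (f i) (1 : ℝ)
  map_add' v w := by simp [add_smul, Finset.sum_add_distrib]
  map_smul' c w := by simp [Finset.smul_sum, mul_smul]

theorem spread_apply_of_injective {k d : ℕ} {f : Fin k → Fin d} (hf : Function.Injective f)
    (w : Vec k) (i : Fin k) : spread f w (f i) = w i := by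
  simp [spread, Pi.single_apply, hf.eq_iff]

theorem spread_apply_of_notMem {k d : ℕ} (f : Fin k → Fin d) (w : Vec k) {j : Fin d}
    (hj : ∀ i, f i ≠ j) : spread f w j = 0 := by
  simp only [spread, LinearMap.coe_mk, AddHom.coe_mk, WithLp.ofLp_sum, Finset.sum_apply,
    WithLp.ofLp_smul, Pi.smul_apply, smul_eq_mul]
  refine Finset.sum_eq_zero fun i _ => ?_
  simp [(hj i).symm]

theorem supp_spread_subset {k d : ℕ} (f : Fin k → Fin d) (w : Vec k) :
    supp (spread f w) ⊆ Finset.univ.image f := by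
  intro j hj
  by_contra h
  refine (Finset.mem_filter.1 hj).2 (spread_apply_of_notMem f w fun i hi => h ?_)
  exact Finset.mem_image.2 ⟨i, Finset.mem_univ _, hi⟩

theorem norm_spread {k d : ℕ} {f : Fin k → Fin d} (hf : Function.Injective f) (w : Vec k) :
    ‖spread f w‖ = ‖w‖ := by
  rw [← sq_eq_sq₀ (norm_nonneg _) (norm_nonneg _), EuclideanSpace.norm_sq_eq,
    EuclideanSpace.norm_sq_eq, ← Finset.sum_subset (Finset.subset_univ (Finset.univ.image f)),
    Finset.sum_image fun a _ b _ h => hf h]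
  · simp_rw [spread_apply_of_injective hf]
  · intro j _ hj
    rw [spread_apply_of_notMem f w fun i hi => hj (Finset.mem_image.2 ⟨i, Finset.mem_univ _, hi⟩)]
    simp

theorem exists_eq_spread {k d : ℕ} {v : Vec d} (hv : l0 v ≤ k) (hk : k ≤ d) :
    ∃ f : Fin k → Fin d, Function.Injective f ∧ ∃ w : Vec k, v = spread f w := by
  obtain ⟨T, hT, hcard⟩ := Finset.exists_superset_card_eq (s := supp v) (n := k) hv
    (by simpa using hk)
  set e := T.equivFinOfCardEq hcard with he
  set f : Fin k → Fin d := fun i => (e.symm i : Fin d) with hf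
  have hinj : Function.Injective f := Subtype.val_injective.comp e.symm.injective
  refine ⟨f, hinj, WithLp.toLp 2 fun i => v (f i), ?_⟩
  ext j
  by_cases hj : j ∈ T
  · have : f (e ⟨j, hj⟩) = j := by simp [hf]
    rw [← this, spread_apply_of_injective hinj]
  · have hne : ∀ i, f i ≠ j := fun i hi => hj (by rw [← hi]; exact (e.symm i).2)
    rw [spread_apply_of_notMem f _ hne]
    by_contra h
    exact hj (hT (by simp [supp, h]))

/-- Restricted isometry: `0.6 ‖v‖² ≤ ‖X v‖² / n ≤ 1.4 ‖v‖²` for all `s`-sparse `v`. -/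
def RestrictedIsometry {n d : ℕ} (X : Matrix (Fin n) (Fin d) ℝ) (s : ℕ) : Prop :=
  ∀ v : Vec d, l0 v ≤ s → 0.6 * ‖v‖ ^ 2 ≤ gramForm X v ∧ gramForm X v ≤ 1.4 * ‖v‖ ^ 2

/-- The linear map `v ↦ X v / √n`, whose squared norm is `gramForm X`. -/
noncomputable def scaledMap {n d : ℕ} (X : Matrix (Fin n) (Fin d) ℝ) : Vec d →ₗ[ℝ] Vec n :=
  (Real.sqrt n)⁻¹ • Matrix.toLpLin 2 2 X

theorem norm_sq_scaledMap {n d : ℕ} (X : Matrix (Fin n) (Fin d) ℝ) (v : Vec d) :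
    ‖scaledMap X v‖ ^ 2 = gramForm X v := by
  rw [scaledMap, LinearMap.smul_apply, norm_smul, mul_pow, EuclideanSpace.norm_sq_eq, gramForm]
  congr 1
  · rw [Real.norm_eq_abs, sq_abs, inv_pow, Real.sq_sqrt (Nat.cast_nonneg n), one_div]
  · simp

theorem restrictedIsometry_of_net {n d s k : ℕ} {X : Matrix (Fin n) (Fin d) ℝ}
    (hks : min s d = k) {N : Finset (Vec k)}
    (hnet : ∀ x : Vec k, ‖x‖ = 1 → ∃ y ∈ N, ‖x - y‖ ≤ 1 / 2) (hN : ∀ y ∈ N, ‖y‖ = 1)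
    (h : ∀ f : Fin k → Fin d, Function.Injective f → ∀ y ∈ N,
      |gramForm X (spread f y) - 1| ≤ 1 / 80) :
    RestrictedIsometry X s := by
  intro v hv
  have hvk : l0 v ≤ k := hks ▸ le_min hv ((Finset.card_le_univ _).trans (by simp))
  obtain ⟨f, hf, w, rfl⟩ := exists_eq_spread hvk (hks ▸ min_le_right _ _)
  have := abs_norm_sq_sub_le_of_net (LinearMap.toContinuousLinearMap (scaledMap X ∘ₗ spread f))
    hnet hN (τ := 1 / 80) (by
      intro y hy
      have := h f hf y hy
      rw [← norm_sq_scaledMap] at this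
      simpa [hN y hy] using this) w
  simp only [LinearMap.coe_toContinuousLinearMap', LinearMap.comp_apply, norm_sq_scaledMap] at this
  rw [norm_spread hf]
  rw [abs_le] at this
  constructor <;> linarith

/-- The number of net points of all sparse supports, with the factor `2 ^ k` of the pointwise
bound, is of order `exp (5 s log d)`. For `d ≤ 1` the logarithm vanishes, but then `k ≤ 1`. -/
theorem net_count_le {s d k : ℕ} (hk : min s d = k) :
    (d : ℝ) ^ k * 5 ^ k * 2 ^ k ≤ 10 * Real.exp (5 * (s * Real.log d)) := by
  rw [← mul_pow, ← mul_pow, mul_assoc]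
  norm_num
  rcases Nat.lt_or_ge d 2 with hd | hd
  · interval_cases d
    · simp at hk
      simp [← hk]
    · have : k ≤ 1 := hk ▸ min_le_right _ _
      interval_cases k <;> norm_num
  · have hd' : (2 : ℝ) ≤ d := by exact_mod_cast hd
    have hks : k ≤ s := hk ▸ min_le_left _ _
    have h1 : (d : ℝ) * 10 ≤ d ^ 5 := by
      have : (2 : ℝ) ^ 4 ≤ d ^ 4 := by gcongr
      nlinarith
    calc ((d : ℝ) * 10) ^ k ≤ (d ^ 5) ^ k := by gcongr
      _ ≤ (d ^ 5) ^ s := by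
          refine pow_le_pow_right₀ ?_ hks
          exact one_le_pow₀ (by linarith)
      _ = Real.exp (5 * (s * Real.log d)) := by
          rw [← pow_mul, ← Real.exp_log (pow_pos (by linarith : (0 : ℝ) < d) _), Real.log_pow]
          push_cast
          ring_nf
      _ ≤ _ := by linarith [Real.exp_pos (5 * (s * Real.log d))]

/-- Restricted isometry holds with high probability as soon as `n ≥ C s log d`. -/
theorem exists_measure_not_restrictedIsometry_le (K : ℝ) (hK : 0 < K) :
    ∃ C : ℝ, 0 < C ∧ ∀ η : ℝ, 0 < η → ∃ N : ℕ, ∀ n d s : ℕ,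
      N ≤ n → 0 < n → C * s * Real.log d ≤ n →
      ∀ (Ω : Type*) [MeasurableSpace Ω] (μ : Measure Ω) [IsProbabilityMeasure μ]
        (X : Ω → Matrix (Fin n) (Fin d) ℝ), IndepRows μ X K ∨ IndepCols μ X K →
        μ {ω | ¬ RestrictedIsometry (X ω) s} ≤ ENNReal.ofReal η := by
  classical
  obtain ⟨c, hc, htail⟩ := measure_gramForm_deviation_le hK (τ := 1 / 80) (by norm_num)
    (by norm_num)
  refine ⟨10 / c, by positivity, fun η hη => ?_⟩
  have hlim : Filter.Tendsto (fun n : ℕ => 20 * Real.exp (-(c / 2 * n))) Filter.atTop (nhds 0) := by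
    have h1 : Filter.Tendsto (fun n : ℕ => c / 2 * (n : ℝ)) Filter.atTop Filter.atTop :=
      tendsto_natCast_atTop_atTop.const_mul_atTop (by positivity)
    simpa using (Real.tendsto_exp_neg_atTop_nhds_zero.comp h1).const_mul 20
  obtain ⟨N, hN⟩ := Filter.eventually_atTop.1 (hlim.eventually_le_const hη)
  refine ⟨N, fun n d s hNn hn hCn Ω _ μ _ X hX => ?_⟩
  set k := min s d with hk
  obtain ⟨A, hAcard, hA1, hAnet⟩ := exists_half_net_sphere k
  set I : Finset ((Fin k → Fin d) × Vec k) :=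
    (Finset.univ.filter Function.Injective) ×ˢ A with hI
  have hcov : {ω | ¬ RestrictedIsometry (X ω) s}
      ⊆ ⋃ p ∈ I, {ω | 1 / 80 < |gramForm (X ω) (spread p.1 p.2) - 1|} := by
    intro ω hω
    by_contra hcon
    refine hω (restrictedIsometry_of_net hk.symm hAnet hA1 fun f hf y hy => ?_)
    by_contra! hlt
    refine hcon (Set.mem_iUnion₂.2 ⟨(f, y), ?_, hlt⟩)
    simp [hI, hf, hy]
  have hIcard : (I.card : ℝ) ≤ d ^ k * 5 ^ k := by
    rw [hI, Finset.card_product]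
    push_cast
    have h1 : (Finset.univ.filter (Function.Injective : (Fin k → Fin d) → Prop)).card ≤ d ^ k :=
      (Finset.card_le_univ _).trans (by simp)
    gcongr
    · exact_mod_cast h1
    · exact_mod_cast hAcard
  have hone : ∀ p ∈ I, μ {ω | 1 / 80 < |gramForm (X ω) (spread p.1 p.2) - 1|}
      ≤ ENNReal.ofReal (2 * (2 ^ k * Real.exp (-c * n))) := by
    rintro ⟨f, y⟩ hp
    simp only [hI, Finset.mem_product, Finset.mem_filter, Finset.mem_univ, true_and] at hp
    have h := htail μ n d X hn hX (spread f y) (Finset.univ.image f)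
      (by rw [norm_spread hp.1, hA1 y hp.2]) (supp_spread_subset f y)
    rw [Finset.card_image_of_injective _ hp.1, Finset.card_univ, Fintype.card_fin] at h
    refine h.trans (le_of_eq ?_)
    rw [ENNReal.ofReal_mul (by norm_num), ENNReal.ofReal_mul (by positivity),
      ENNReal.ofReal_pow (by norm_num)]
    simp
  calc μ {ω | ¬ RestrictedIsometry (X ω) s}
      ≤ ∑ p ∈ I, μ {ω | 1 / 80 < |gramForm (X ω) (spread p.1 p.2) - 1|} :=
        (measure_mono hcov).trans (measure_biUnion_finset_le _ _)
    _ ≤ ∑ _p ∈ I, ENNReal.ofReal (2 * (2 ^ k * Real.exp (-c * n))) := Finset.sum_le_sum hone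
    _ = ENNReal.ofReal (I.card * (2 * (2 ^ k * Real.exp (-c * n)))) := by
        rw [Finset.sum_const, nsmul_eq_mul, ENNReal.ofReal_mul (Nat.cast_nonneg _),
          ENNReal.ofReal_natCast]
    _ ≤ ENNReal.ofReal η := by
        refine ENNReal.ofReal_le_ofReal (le_trans ?_ (hN n hNn))
        have h5 : 5 * (s * Real.log d) ≤ c / 2 * n := by
          have h6 : 10 / c * s * Real.log d = (5 * (s * Real.log d)) / (c / 2) := by
            field_simp; ring
          rw [h6, div_le_iff₀ (by positivity)] at hCn
          linarith
        calc (I.card : ℝ) * (2 * (2 ^ k * Real.exp (-c * n)))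
            ≤ d ^ k * 5 ^ k * (2 * (2 ^ k * Real.exp (-c * n))) := by gcongr
          _ = 2 * (d ^ k * 5 ^ k * 2 ^ k) * Real.exp (-c * n) := by ring
          _ ≤ 2 * (10 * Real.exp (5 * (s * Real.log d))) * Real.exp (-c * n) := by
              have := net_count_le hk.symm
              exact mul_le_mul_of_nonneg_right (by linarith) (Real.exp_pos _).le
          _ ≤ 2 * (10 * Real.exp (c / 2 * n)) * Real.exp (-c * n) := by gcongr
          _ = 20 * Real.exp (-(c / 2 * n)) := by
              rw [mul_assoc, mul_assoc, ← Real.exp_add]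
              ring_nf

/-! ### Sparse vectors, coordinate moves and gradients -/

section Basic

variable {d : ℕ}

theorem notMem_supp {v : Vec d} {j : Fin d} : j ∉ supp v ↔ v j = 0 := by
  simp [supp]

theorem supp_subset_iff {v : Vec d} {F : Finset (Fin d)} :
    supp v ⊆ F ↔ ∀ j, j ∉ F → v j = 0 :=
  ⟨fun h j hj => notMem_supp.1 fun hjs => hj (h hjs),
    fun h j hj => by by_contra hjF; exact (Finset.mem_filter.1 hj).2 (h j hjF)⟩

theorem l0_le_card {v : Vec d} {F : Finset (Fin d)} (h : supp v ⊆ F) : l0 v ≤ F.card :=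
  Finset.card_le_card h

theorem supp_zero : supp (0 : Vec d) = ∅ := by simp [supp]

theorem supp_sub_subset {v w : Vec d} {F : Finset (Fin d)} (hv : supp v ⊆ F) (hw : supp w ⊆ F) :
    supp (v - w) ⊆ F := by
  rw [supp_subset_iff] at *
  intro j hj
  simp [hv j hj, hw j hj]

theorem supp_smul_subset (c : ℝ) (v : Vec d) : supp (c • v) ⊆ supp v := by
  rw [supp_subset_iff]
  intro j hj
  simp [notMem_supp.1 hj]

theorem move_apply_same (β : Vec d) (j : Fin d) (a : ℝ) : move β j a j = β j + a := by
  simp [move]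

theorem move_apply_of_ne (β : Vec d) {j i : Fin d} (h : i ≠ j) (a : ℝ) : move β j a i = β i := by
  simp [move, h]

theorem move_zero (β : Vec d) (j : Fin d) : move β j 0 = β := by simp [move]

theorem move_sub_self (β : Vec d) (j : Fin d) (a : ℝ) :
    move β j a - β = a • EuclideanSpace.single j (1 : ℝ) := by simp [move]

theorem norm_move_sub_self (β : Vec d) (j : Fin d) (a : ℝ) : ‖move β j a - β‖ ^ 2 = a ^ 2 := by
  simp [move_sub_self, norm_smul]

theorem l0_move_sub_self_le (β : Vec d) (j : Fin d) (a : ℝ) : l0 (move β j a - β) ≤ 1 := by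
  have : supp (move β j a - β) ⊆ {j} := by
    rw [supp_subset_iff]
    intro i hi
    have : i ≠ j := by simpa using hi
    simp [move_sub_self, this]
  simpa using l0_le_card this

theorem supp_move_subset {β : Vec d} {F : Finset (Fin d)} (h : supp β ⊆ F) (j : Fin d) (a : ℝ) :
    supp (move β j a) ⊆ insert j F := by
  rw [supp_subset_iff] at *
  intro i hi
  rw [Finset.mem_insert, not_or] at hi
  rw [move_apply_of_ne _ hi.1, h i hi.2]

theorem supp_move_neg_subset {β : Vec d} {F : Finset (Fin d)} (h : supp β ⊆ F) (j : Fin d) :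
    supp (move β j (-β j)) ⊆ F.erase j := by
  rw [supp_subset_iff] at *
  intro i hi
  rcases eq_or_ne i j with rfl | hij
  · simp [move_apply_same]
  · rw [move_apply_of_ne _ hij, h i fun hiF => hi (Finset.mem_erase.2 ⟨hij, hiF⟩)]

theorem inner_eq_sum (v w : Vec d) : inner ℝ v w = ∑ j, v j * w j := by
  simp [PiLp.inner_apply, mul_comm]

theorem norm_sq_eq_sum (v : Vec d) : ‖v‖ ^ 2 = ∑ j, v j ^ 2 := by
  simp [EuclideanSpace.norm_sq_eq]

theorem hasDerivAt_move {Q : Vec d → ℝ} (hQ : Differentiable ℝ Q) (β : Vec d) (j : Fin d) :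
    HasDerivAt (fun a => Q (move β j a)) (gradient Q β j) 0 := by
  have h1 : HasGradientAt Q (gradient Q β) β := (hQ β).hasGradientAt
  have h2 : HasDerivAt (fun a : ℝ => move β j a) (EuclideanSpace.single j (1 : ℝ)) 0 := by
    simpa [move] using ((hasDerivAt_id (0 : ℝ)).smul_const
      (EuclideanSpace.single j (1 : ℝ) : Vec d)).const_add β
  have h3 := h1.hasFDerivAt
  rw [← move_zero β j] at h3
  have h4 := h3.comp_hasDerivAt (0 : ℝ) h2
  rw [move_zero] at h4
  have h5 : (InnerProductSpace.toDual ℝ (Vec d)) (gradient Q β)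
      (EuclideanSpace.single j (1 : ℝ)) = gradient Q β j := by
    rw [InnerProductSpace.toDual_apply_apply, EuclideanSpace.inner_single_right]
    simp
  rw [h5] at h4
  exact h4

theorem continuous_move (β : Vec d) (j : Fin d) : Continuous fun a => move β j a := by
  unfold move; fun_prop

theorem IsRestrictedMin.gradient_eq_zero {Q : Vec d → ℝ} (hQ : Differentiable ℝ Q)
    {F : Finset (Fin d)} {β : Vec d} (h : IsRestrictedMin Q F β) {j : Fin d} (hj : j ∈ F) :
    gradient Q β j = 0 := by
  refine IsLocalMin.hasDerivAt_eq_zero (Filter.Eventually.of_forall fun a => ?_)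
    (hasDerivAt_move hQ β j)
  simp only [move_zero]
  refine h.2 _ ?_
  have := supp_move_subset h.1 j a
  rwa [Finset.insert_eq_of_mem hj] at this

theorem IsRestrictedMin.mem_sublevel {Q : Vec d → ℝ} {F : Finset (Fin d)} {β : Vec d} {s : ℕ}
    (h : IsRestrictedMin Q F β) (hF : F.card ≤ s) : β ∈ sublevel Q s :=
  ⟨(l0_le_card h.1).trans hF, h.2 0 (by simp [supp_zero])⟩

theorem zero_mem_sublevel (Q : Vec d → ℝ) (s : ℕ) : (0 : Vec d) ∈ sublevel Q s :=
  ⟨by simp [l0, supp_zero], le_rfl⟩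

theorem abs_gradient_le_gradSup (Q : Vec d → ℝ) (β : Vec d) (j : Fin d) :
    |gradient Q β j| ≤ gradSup Q β :=
  norm_le_pi_norm (gradient Q β).ofLp j

theorem bregman_move {Q : Vec d → ℝ} (β : Vec d) (j : Fin d) (a : ℝ) :
    bregman Q β (move β j a) = Q (move β j a) - Q β - a * gradient Q β j := by
  rw [bregman, move_sub_self, inner_smul_right, EuclideanSpace.inner_single_right]
  simp

end Basic

/-! ### Consequences of restricted strong convexity and smoothness -/

/-- Real constants with the properties that `ρ₋(s)`, `ρ₊(s)` and `ρ₊(1)` have: `m` is a restricted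
strong convexity constant, and `U`, `L` are restricted smoothness constants for differences with
at most `s`, respectively `1`, nonzero entries. -/
structure Regular {d : ℕ} (Q : Vec d → ℝ) (s : ℕ) (m U L : ℝ) : Prop where
  convex : ConvexOn ℝ Set.univ Q
  diff : Differentiable ℝ Q
  m_pos : 0 < m
  U_nonneg : 0 ≤ U
  L_nonneg : 0 ≤ L
  lower : ∀ β ∈ sublevel Q s, ∀ β' ∈ sublevel Q s, l0 (β' - β) ≤ s →
    m / 2 * ‖β' - β‖ ^ 2 ≤ bregman Q β β'
  upper : ∀ β ∈ sublevel Q s, ∀ β' ∈ sublevel Q s, l0 (β' - β) ≤ s →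
    bregman Q β β' ≤ U / 2 * ‖β' - β‖ ^ 2
  upper_one : ∀ β ∈ sublevel Q s, ∀ β' ∈ sublevel Q s, l0 (β' - β) ≤ 1 →
    bregman Q β β' ≤ L / 2 * ‖β' - β‖ ^ 2

namespace Regular

variable {d : ℕ} {Q : Vec d → ℝ} {s : ℕ} {m U L : ℝ}

theorem lower_zero (h : Regular Q s m U L) {β : Vec d} (hβ : β ∈ sublevel Q s) :
    m / 2 * ‖β‖ ^ 2 ≤ Q β - Q 0 + ‖gradient Q 0‖ * ‖β‖ := by
  have h1 := h.lower 0 (zero_mem_sublevel Q s) β hβ (by simpa using hβ.1)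
  rw [bregman, sub_zero] at h1
  have h2 := (abs_le.1 (abs_real_inner_le_norm (gradient Q 0) β)).1
  linarith

theorem norm_le (h : Regular Q s m U L) {β : Vec d} (hβ : β ∈ sublevel Q s) :
    ‖β‖ ≤ 2 * ‖gradient Q 0‖ / m := by
  have h1 := h.lower_zero hβ
  have h2 := hβ.2
  have hm := h.m_pos
  rw [le_div_iff₀ hm]
  rcases (norm_nonneg β).eq_or_lt with h0 | h0
  · rw [← h0]; simp
  · have h3 : m / 2 * ‖β‖ * ‖β‖ ≤ ‖gradient Q 0‖ * ‖β‖ := by nlinarith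
    have := le_of_mul_le_mul_right h3 h0
    linarith

theorem sub_le (h : Regular Q s m U L) {β : Vec d} (hβ : β ∈ sublevel Q s) :
    Q 0 - Q β ≤ ‖gradient Q 0‖ ^ 2 / (2 * m) := by
  have h1 := h.lower_zero hβ
  have hm := h.m_pos
  rw [le_div_iff₀ (by positivity)]
  nlinarith [sq_nonneg (m * ‖β‖ - ‖gradient Q 0‖)]

/-- A minimizer exists on every closed set of `s`-sparse vectors that meets the sublevel set. -/
theorem exists_min (h : Regular Q s m U L) {S : Set (Vec d)} (hS : IsClosed S)
    (hs : ∀ β ∈ S, l0 β ≤ s) {β₀ : Vec d} (h0 : β₀ ∈ S) (hQ0 : Q β₀ ≤ Q 0) :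
    ∃ β ∈ S, ∀ β' ∈ S, Q β ≤ Q β' := by
  have hc : IsClosed (S ∩ {β | Q β ≤ Q 0}) :=
    hS.inter (isClosed_le h.diff.continuous continuous_const)
  have hb : Bornology.IsBounded (S ∩ {β | Q β ≤ Q 0}) := by
    refine (Metric.isBounded_closedBall (x := (0 : Vec d))
      (r := 2 * ‖gradient Q 0‖ / m)).subset fun β hβ => ?_
    simpa using h.norm_le ⟨hs β hβ.1, hβ.2⟩
  obtain ⟨β, hβ, hmin⟩ := (Metric.isCompact_of_isClosed_isBounded hc hb).exists_isMinOn
    ⟨β₀, h0, hQ0⟩ h.diff.continuous.continuousOn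
  refine ⟨β, hβ.1, fun β' hβ' => ?_⟩
  by_cases hle : Q β' ≤ Q 0
  · exact hmin ⟨hβ', hle⟩
  · exact hβ.2.trans (not_le.1 hle).le

theorem exists_restrictedMin (h : Regular Q s m U L) {F : Finset (Fin d)} (hF : F.card ≤ s) :
    ∃ β, IsRestrictedMin Q F β := by
  have hc : IsClosed {β : Vec d | supp β ⊆ F} := by
    simp_rw [supp_subset_iff, Set.ofPred_forall]
    refine isClosed_iInter fun j => isClosed_iInter fun _ => ?_
    exact isClosed_eq (by fun_prop) continuous_const
  obtain ⟨β, hβ, hmin⟩ := h.exists_min hc (fun β hβ => (l0_le_card hβ).trans hF)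
    (β₀ := 0) (by simp [supp_zero]) le_rfl
  exact ⟨β, hβ, hmin⟩

theorem exists_move_min (h : Regular Q s m U L) {β : Vec d} (hβ : Q β ≤ Q 0) (j : Fin d)
    (hj : ∀ a, l0 (move β j a) ≤ s) : ∃ a₀, ∀ a, Q (move β j a₀) ≤ Q (move β j a) := by
  set S : Set (Vec d) := {x | ∀ i, i ≠ j → x i = β i} with hS
  have hmem : ∀ x ∈ S, x = move β j (x j - β j) := by
    intro x hx
    ext i
    rcases eq_or_ne i j with rfl | hij
    · simp [move_apply_same]
    · rw [move_apply_of_ne _ hij, hx i hij]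
  have hc : IsClosed S := by
    simp_rw [hS, Set.ofPred_forall]
    refine isClosed_iInter fun j => isClosed_iInter fun _ => ?_
    exact isClosed_eq (by fun_prop) continuous_const
  obtain ⟨x, hx, hmin⟩ := h.exists_min hc (fun x hx => hmem x hx ▸ hj _) (β₀ := β)
    (fun _ _ => rfl) hβ
  refine ⟨x j - β j, fun a => ?_⟩
  rw [← hmem x hx]
  exact hmin _ fun i hi => move_apply_of_ne _ hi a

/-- A single-coordinate step decreases `Q` by at least `(∇Q(β)_j)² / (2 L)`, the usual descent
lemma. The smoothness bound is available only inside the sublevel set, which the step of length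
`|∇Q(β)_j| / L` does not leave. -/
theorem exists_move_descent (h : Regular Q s m U L) {β : Vec d} (hβ : Q β ≤ Q 0) (j : Fin d)
    (hj : ∀ a, l0 (move β j a) ≤ s) :
    ∃ a, gradient Q β j ^ 2 ≤ 2 * L * (Q β - Q (move β j a)) := by
  set g := gradient Q β j with hg
  rcases eq_or_ne g 0 with hg0 | hg0
  · exact ⟨0, by simp [hg0, move_zero]⟩
  have hg2 : 0 < g ^ 2 := by positivity
  have hβs : β ∈ sublevel Q s := ⟨by simpa [move_zero] using hj 0, hβ⟩
  -- The smoothness bound along the direction `-g e_j`.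
  have hsm : ∀ t : ℝ, Q (move β j (t * -g)) ≤ Q β →
      Q (move β j (t * -g)) - Q β + t * g ^ 2 ≤ L / 2 * (t ^ 2 * g ^ 2) := by
    intro t ht
    have h1 := h.upper_one β hβs _ ⟨hj (t * -g), ht.trans hβ⟩ (l0_move_sub_self_le β j _)
    rw [bregman_move, norm_move_sub_self, ← hg] at h1
    nlinarith
  have hder : HasDerivAt (fun t : ℝ => Q (move β j (t * -g))) (g * -g) 0 := by
    have h1 := hasDerivAt_move h.diff β j
    have h2 : HasDerivAt (fun t : ℝ => t * -g) (-g) 0 := by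
      simpa using (hasDerivAt_id (0 : ℝ)).mul_const (-g)
    have h3 : HasDerivAt (fun a => Q (move β j a)) g ((fun t : ℝ => t * -g) 0) := by
      simpa using h1
    exact h3.comp (0 : ℝ) h2
  have hsmall : ∀ ε : ℝ, 0 < ε → ∃ t, 0 < t ∧ t < ε ∧ Q (move β j (t * -g)) < Q β := by
    intro ε hε
    have h1 := hder.hasDerivWithinAt (s := Set.Ioi 0)
    have h2 := (hasDerivWithinAt_iff_tendsto_slope' (by simp)).1 h1
    have h3 := h2.eventually (gt_mem_nhds (show g * -g < 0 by nlinarith))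
    obtain ⟨t, ht, ht1⟩ := (h3.and (Ioo_mem_nhdsGT hε)).exists
    refine ⟨t, ht1.1, ht1.2, ?_⟩
    rw [slope_def_field, sub_zero, div_neg_iff] at ht
    simp only [zero_mul, move_zero] at ht
    rcases ht with ht | ht
    · exact absurd ht1.1 (not_lt.2 ht.2.le)
    · linarith [ht.1]
  have hL : 0 < L := by
    obtain ⟨t, ht0, _, ht⟩ := hsmall 1 one_pos
    have h1 := hsm t ht.le
    by_contra hL
    have : L = 0 := le_antisymm (not_lt.1 hL) h.L_nonneg
    rw [this] at h1
    -- With `L = 0` the function would be linear along the direction, contradicting `m > 0`.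
    have h2 := h.lower β hβs _ ⟨hj (t * -g), ht.le.trans hβ⟩ (by
      have h4 : 1 ≤ s := by
        have h5 := hj (1 - β j)
        have h6 : 1 ≤ l0 (move β j (1 - β j)) := by
          refine Finset.card_pos.2 ⟨j, ?_⟩
          simp [supp, move_apply_same]
        exact h6.trans h5
      exact (l0_move_sub_self_le β j _).trans h4)
    rw [bregman_move, norm_move_sub_self, ← hg] at h2
    have hm := h.m_pos
    have h3 : 0 < m / 2 * (t * -g) ^ 2 :=
      mul_pos (half_pos hm) (by rw [mul_pow, neg_sq]; positivity)
    nlinarith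
  have hle : Q (move β j (1 / L * -g)) ≤ Q β := by
    by_contra! hgt
    obtain ⟨t₁, ht0, ht1, hlt⟩ := hsmall (1 / L) (by positivity)
    have hcont : Continuous fun t : ℝ => Q (move β j (t * -g)) :=
      h.diff.continuous.comp ((continuous_move β j).comp (continuous_id.mul continuous_const))
    obtain ⟨t, ⟨htl, htr⟩, ht⟩ := intermediate_value_Icc ht1.le hcont.continuousOn
      (show Q β ∈ Set.Icc _ _ from ⟨hlt.le, hgt.le⟩)
    simp only at ht
    have h1 := hsm t ht.le
    rw [ht] at h1
    have ht' : 0 < t := ht0.trans_le htl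
    have h2 : t * L ≤ 1 := by rwa [le_div_iff₀ hL] at htr
    have h3 : 0 < t * g ^ 2 := by positivity
    nlinarith
  refine ⟨1 / L * -g, ?_⟩
  have h1 := hsm _ hle
  have h2 : L / 2 * ((1 / L) ^ 2 * g ^ 2) = 1 / 2 * (1 / L * g ^ 2) := by field_simp
  have h3 : L * (1 / L * g ^ 2) = g ^ 2 := by field_simp
  nlinarith

/-- If removing the coordinate `j` of a restricted minimizer increases `Q` by at least `c`, then
`c ≤ L β_j² / 2`. When the removal leaves the sublevel set, smoothness is applied at the point
where the segment crosses the level `Q 0`, and `c ≤ Q 0 - Q β` is used instead. -/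
theorem le_of_removal (h : Regular Q s m U L) {F : Finset (Fin d)} {β : Vec d}
    (hβ : IsRestrictedMin Q F β) (hF : F.card ≤ s) {j : Fin d} (hj : j ∈ F) {c : ℝ}
    (hc : c ≤ Q (move β j (-β j)) - Q β) (hc0 : c ≤ Q 0 - Q β) : c ≤ L / 2 * β j ^ 2 := by
  have hβs := hβ.mem_sublevel hF
  have hL := h.L_nonneg
  have hl0 : ∀ a, l0 (move β j a) ≤ s := fun a => by
    have := supp_move_subset hβ.1 j a
    rw [Finset.insert_eq_of_mem hj] at this
    exact (l0_le_card this).trans hF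
  have hsm : ∀ t : ℝ, Q (move β j (t * -β j)) ≤ Q 0 →
      Q (move β j (t * -β j)) - Q β ≤ L / 2 * (t ^ 2 * β j ^ 2) := by
    intro t ht
    have h1 := h.upper_one β hβs _ ⟨hl0 (t * -β j), ht⟩ (l0_move_sub_self_le β j _)
    rw [bregman_move, norm_move_sub_self, hβ.gradient_eq_zero h.diff hj] at h1
    nlinarith
  by_cases hle : Q (move β j (-β j)) ≤ Q 0
  · have h1 := hsm 1 (by simpa using hle)
    rw [one_mul] at h1
    linarith
  · have hcont : Continuous fun t : ℝ => Q (move β j (t * -β j)) :=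
      h.diff.continuous.comp ((continuous_move β j).comp (continuous_id.mul continuous_const))
    obtain ⟨t, ⟨ht0, ht1⟩, ht⟩ := intermediate_value_Icc zero_le_one hcont.continuousOn
      (show Q 0 ∈ Set.Icc _ _ from ⟨by simpa [move_zero] using hβs.2,
        by simpa using (not_le.1 hle).le⟩)
    simp only at ht
    have h1 := hsm t ht.le
    rw [ht] at h1
    have h2 : L / 2 * (t ^ 2 * β j ^ 2) ≤ L / 2 * (1 * β j ^ 2) := by
      gcongr
      exact pow_le_one₀ ht0 ht1
    linarith

/-- Around a minimizer over the feature set `F` the linear term vanishes on `F`, so the excess of `Q`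
at a point supported in `F` is comparable to the squared distance. -/
theorem lower_of_restrictedMin (h : Regular Q s m U L) {F : Finset (Fin d)} {β β' : Vec d}
    (hβ : IsRestrictedMin Q F β) (hF : F.card ≤ s) (hβ' : β' ∈ sublevel Q s)
    (hsub : supp β' ⊆ F) :
    m / 2 * ‖β' - β‖ ^ 2 ≤ Q β' - Q β ∧ Q β' - Q β ≤ U / 2 * ‖β' - β‖ ^ 2 := by
  have hs : supp (β' - β) ⊆ F := supp_sub_subset hsub hβ.1
  have h0 : inner ℝ (gradient Q β) (β' - β) = 0 := by
    rw [inner_eq_sum]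
    refine Finset.sum_eq_zero fun j _ => ?_
    by_cases hj : j ∈ F
    · rw [hβ.gradient_eq_zero h.diff hj, zero_mul]
    · rw [supp_subset_iff.1 hs j hj, mul_zero]
  have hl := (l0_le_card hs).trans hF
  have h1 := h.lower β (hβ.mem_sublevel hF) β' hβ' hl
  have h2 := h.upper β (hβ.mem_sublevel hF) β' hβ' hl
  rw [bregman, h0, sub_zero] at h1 h2
  exact ⟨h1, h2⟩

/-- If `A` bounds the squares of the partial derivatives at `β` outside `F`, the value of `Q` on
a feature set `F' ⊇ F` is at most `|F' \ F| A / (2 m)` lower than the one at `β`. -/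
theorem sub_le_of_gradient_sq_le (h : Regular Q s m U L) {F F' : Finset (Fin d)} {β β' : Vec d}
    (hβ : IsRestrictedMin Q F β) (hFF : F ⊆ F') (hF' : F'.card ≤ s) (hβ' : β' ∈ sublevel Q s)
    (hsub : supp β' ⊆ F') {A : ℝ} (hA : ∀ j, j ∉ F → gradient Q β j ^ 2 ≤ A) :
    Q β - Q β' ≤ (F' \ F).card * A / (2 * m) := by
  have hm := h.m_pos
  have hs : supp (β' - β) ⊆ F' := supp_sub_subset hsub (hβ.1.trans hFF)
  have h1 := h.lower β (hβ.mem_sublevel ((Finset.card_le_card hFF).trans hF')) β' hβ'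
    ((l0_le_card hs).trans hF')
  rw [bregman, inner_eq_sum, norm_sq_eq_sum] at h1
  have h2 : ∑ j, gradient Q β j * (β' - β) j
      = ∑ j ∈ F' \ F, gradient Q β j * (β' - β) j := by
    refine (Finset.sum_subset (Finset.subset_univ _) fun j _ hj => ?_).symm
    by_cases hjF : j ∈ F
    · rw [hβ.gradient_eq_zero h.diff hjF, zero_mul]
    · rw [supp_subset_iff.1 hs j fun hjF' => hj (Finset.mem_sdiff.2 ⟨hjF', hjF⟩), mul_zero]
  have h3 : ∑ j ∈ F' \ F, (β' - β) j ^ 2 ≤ ∑ j, (β' - β) j ^ 2 :=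
    Finset.sum_le_sum_of_subset_of_nonneg (Finset.subset_univ _) fun _ _ _ => sq_nonneg _
  have h4 : ∀ j ∈ F' \ F,
      -(A / (2 * m)) ≤ gradient Q β j * (β' - β) j + m / 2 * (β' - β) j ^ 2 := by
    intro j hj
    have h5 := hA j (Finset.mem_sdiff.1 hj).2
    set x := (β' - β) j
    set g := gradient Q β j
    have h6 : g * x + m / 2 * x ^ 2 + A / (2 * m) = ((g + m * x) ^ 2 + (A - g ^ 2)) / (2 * m) := by
      field_simp; ring
    have : 0 ≤ ((g + m * x) ^ 2 + (A - g ^ 2)) / (2 * m) := by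
      have := sq_nonneg (g + m * x)
      exact div_nonneg (by linarith) (by linarith)
    linarith
  have h5 := Finset.sum_le_sum h4
  rw [Finset.sum_const, Finset.sum_add_distrib, ← Finset.mul_sum, nsmul_eq_mul] at h5
  rw [h2] at h1
  have h6 : m / 2 * ∑ j ∈ F' \ F, (β' - β) j ^ 2 ≤ m / 2 * ∑ j, (β' - β) j ^ 2 := by gcongr
  have h7 : ((F' \ F).card : ℝ) * A / (2 * m) = (F' \ F).card * (A / (2 * m)) := by ring
  rw [h7]
  linarith

end Regular

/-! ### The number of selected features after a forward step -/

section Counting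

variable {d : ℕ} {Q : Vec d → ℝ} {s : ℕ} {m U L : ℝ}

/-- `δ₀` is a lower bound for the gain of every forward step: for FoBa-obj the failed stopping
test gives it directly, for FoBa-gdt the failed test gives a partial derivative of size at least
`τ`, and the gain `g` satisfies `τ² ≤ 2 L g`. -/
def GainThreshold (L τ δ₀ : ℝ) : Variant → Prop
  | .obj => δ₀ ≤ τ
  | .gdt => ∀ g : ℝ, τ ^ 2 ≤ 2 * L * g → δ₀ ≤ g

/-- The largest number of features at which the outer loop can be. -/
noncomputable def levelBound (κ : ℝ) (kbar : ℕ) : ℝ :=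
  kbar + 2 * (kbar + 1) * ((1 + Real.sqrt κ) ^ 2 * κ ^ 2)

theorem l0_move_le {β : Vec d} {F : Finset (Fin d)} (h : supp β ⊆ F) (hF : F.card + 1 ≤ s)
    (j : Fin d) (a : ℝ) : l0 (move β j a) ≤ s :=
  (l0_le_card (supp_move_subset h j a)).trans ((Finset.card_insert_le _ _).trans hF)

theorem exists_notMem_of_test_fails (hQ : Differentiable ℝ Q) {F : Finset (Fin d)} {β : Vec d}
    (hβ : IsRestrictedMin Q F β) {v : Variant} {τ : ℝ} (hτ : 0 < τ) (h : ¬ Stop Q τ F β v) :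
    ∃ j, j ∉ F ∧ match v with
      | .obj => ∃ a, τ ≤ Q β - Q (move β j a)
      | .gdt => τ ≤ |gradient Q β j| := by
  cases v with
  | obj =>
    simp only [Stop] at h
    push Not at h
    obtain ⟨j, hj, a, ha⟩ := h
    exact ⟨j, hj, a, ha⟩
  | gdt =>
    simp only [Stop] at h
    push Not at h
    obtain ⟨j, hj⟩ := h
    refine ⟨j, fun hjF => ?_, hj⟩
    rw [hβ.gradient_eq_zero hQ hjF, abs_zero] at hj
    linarith

namespace Regular

/-- The gain of a forward step dominates both `δ₀` and all partial derivatives at the previous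
iterate. -/
theorem forward_gain (h : Regular Q s m U L) {F : Finset (Fin d)} {β β' : Vec d} {i : Fin d}
    {v : Variant} {τ δ₀ : ℝ} (hτ : 0 < τ) (hδ : GainThreshold L τ δ₀ v)
    (hF : F.card + 1 ≤ s) (hβ : IsRestrictedMin Q F β) (htest : ¬ Stop Q τ F β v)
    (hi : Selects Q F β i v) (hβ' : IsRestrictedMin Q (insert i F) β') :
    i ∉ F ∧ (∀ j, j ∉ F → gradient Q β j ^ 2 ≤ 2 * L * (Q β - Q β')) ∧ δ₀ ≤ Q β - Q β' := by
  have hL := h.L_nonneg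
  have hQ0 : Q β ≤ Q 0 := hβ.2 0 (by simp [supp_zero])
  have hle : ∀ a, Q β' ≤ Q (move β i a) := fun a => hβ'.2 _ (supp_move_subset hβ.1 i a)
  obtain ⟨j₀, hj₀, hj₀'⟩ := exists_notMem_of_test_fails h.diff hβ hτ htest
  cases v with
  | obj =>
    obtain ⟨hiF, a₀, ha₀⟩ := hi
    refine ⟨hiF, fun j hj => ?_, ?_⟩
    · obtain ⟨a, ha⟩ := h.exists_move_descent hQ0 j (l0_move_le hβ.1 hF j)
      have := (hle a₀).trans (ha₀ j hj a)
      refine ha.trans (mul_le_mul_of_nonneg_left (by linarith) (by linarith))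
    · obtain ⟨a, ha⟩ := hj₀'
      have := (hle a₀).trans (ha₀ j₀ hj₀ a)
      exact (show δ₀ ≤ τ from hδ).trans (by linarith)
  | gdt =>
    obtain ⟨hiF, hmax⟩ := hi
    have hall : ∀ j, j ∉ F → gradient Q β j ^ 2 ≤ 2 * L * (Q β - Q β') := by
      intro j hj
      obtain ⟨a, ha⟩ := h.exists_move_descent hQ0 i (l0_move_le hβ.1 hF i)
      refine (sq_le_sq.2 (hmax j hj)).trans (ha.trans ?_)
      exact mul_le_mul_of_nonneg_left (by linarith [hle a]) (by linarith)
    refine ⟨hiF, hall, hδ _ ?_⟩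
    refine le_trans ?_ (hall j₀ hj₀)
    rw [← sq_abs (gradient Q β j₀)]
    exact pow_le_pow_left₀ hτ.le hj₀' 2

/-- If no feature is removed right after a forward step of gain `g`, the number of selected
features is at most `levelBound κ kbar`.

Every selected feature outside `supp βbar` then has a coefficient with `g ≤ L β_i²`, so that
`|F \ supp βbar| g ≤ L ‖β - βbar‖²`. If `Q β ≤ Q βbar`, this distance is controlled by the
gradient at `βbar`, and the threshold excludes any such feature. Otherwise it is compared with the
minimizer over the union of the two feature sets, whose value is controlled by the gain `g`. -/
theorem card_le_levelBound (h : Regular Q s m U L) {κ : ℝ} (hU : U ≤ κ * m) (hL : L ≤ κ * m)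
    {kbar : ℕ} {βbar : Vec d} (hbar : l0 βbar ≤ kbar) (hmin : IsRestrictedMin Q (supp βbar) βbar)
    {δ₀ : ℝ} (hδ₀ : 0 < δ₀) (hnoise : 4 * L * gradSup Q βbar ^ 2 < δ₀ * m ^ 2)
    {F : Finset (Fin d)} {i : Fin d} {β β' : Vec d} {g : ℝ}
    (hF : (insert i F).card + kbar ≤ s) (hβ : IsRestrictedMin Q F β)
    (hβ' : IsRestrictedMin Q (insert i F) β') (hg : g = Q β - Q β') (hgδ : δ₀ ≤ g)
    (hgrad : ∀ j, j ∉ F → gradient Q β j ^ 2 ≤ 2 * L * g)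
    (hleave : ∀ j ∈ insert i F, g / 2 ≤ Q (move β' j (-β' j)) - Q β') :
    ((insert i F).card : ℝ) ≤ levelBound κ kbar := by
  classical
  have hm := h.m_pos
  have hL0 := h.L_nonneg
  have hg0 : 0 < g := hδ₀.trans_le hgδ
  have hκ : 0 ≤ κ := by
    by_contra! hκ
    have := h.U_nonneg
    nlinarith
  set F₁ := insert i F with hF₁
  set G := supp βbar with hG
  set D := F₁ \ G with hD
  set E := F₁ ∪ G with hE
  have hGcard : G.card ≤ kbar := hbar
  have hEcard : E.card ≤ s :=
    (Finset.card_union_le _ _).trans ((Nat.add_le_add_left hGcard _).trans hF)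
  have hF₁s : F₁.card ≤ s := by omega
  have hQβ0 : Q β ≤ Q 0 := hβ.2 0 (by simp [supp_zero])
  have hbarD : ∀ j ∈ D, βbar j = 0 := fun j hj => notMem_supp.1 (Finset.mem_sdiff.1 hj).2
  have hcard : (F₁.card : ℝ) ≤ kbar + D.card := by
    have h1 : F₁.card ≤ G.card + D.card := by
      rw [add_comm]
      exact Finset.card_le_card_sdiff_add_card
    exact_mod_cast h1.trans (Nat.add_le_add_right hGcard _)
  suffices hmain : (D.card : ℝ) ≤ 2 * (kbar + 1) * ((1 + Real.sqrt κ) ^ 2 * κ ^ 2) by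
    rw [levelBound]
    linarith
  have hsumD : ∑ j ∈ D, (β' - βbar) j ^ 2 ≤ ‖β' - βbar‖ ^ 2 := by
    rw [norm_sq_eq_sum]
    exact Finset.sum_le_sum_of_subset_of_nonneg (Finset.subset_univ _) fun _ _ _ => sq_nonneg _
  have hDg : D.card * g ≤ L * ‖β' - βbar‖ ^ 2 := by
    have h1 : ∀ j ∈ D, g ≤ L * (β' - βbar) j ^ 2 := by
      intro j hj
      have hjF : j ∈ F₁ := (Finset.mem_sdiff.1 hj).1
      have h2 := h.le_of_removal hβ' hF₁s hjF (hleave j hjF) (by linarith)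
      have h3 : (β' - βbar) j = β' j := by simp [hbarD j hj]
      rw [h3]
      linarith
    have h2 := Finset.sum_le_sum h1
    rw [Finset.sum_const, nsmul_eq_mul, ← Finset.mul_sum] at h2
    exact h2.trans (mul_le_mul_of_nonneg_left hsumD hL0)
  have hβ's := hβ'.mem_sublevel hF₁s
  have hbars : βbar ∈ sublevel Q s := hmin.mem_sublevel (hGcard.trans (by omega))
  have hsub' : supp β' ⊆ E := hβ'.1.trans Finset.subset_union_left
  have hsubbar : supp βbar ⊆ E := Finset.subset_union_right
  rcases le_or_gt (Q β') (Q βbar) with hcase | hcase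
  · set Γ := gradSup Q βbar with hΓ
    have h1 := h.lower βbar hbars β' hβ's ((l0_le_card (supp_sub_subset hsub' hsubbar)).trans hEcard)
    rw [bregman, inner_eq_sum] at h1
    have h2 : ∑ j, gradient Q βbar j * (β' - βbar) j
        = ∑ j ∈ D, gradient Q βbar j * (β' - βbar) j := by
      refine (Finset.sum_subset (Finset.subset_univ _) fun j _ hj => ?_).symm
      by_cases hjG : j ∈ G
      · rw [hmin.gradient_eq_zero h.diff hjG, zero_mul]
      · have hjF : j ∉ F₁ := fun hjF => hj (Finset.mem_sdiff.2 ⟨hjF, hjG⟩)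
        have h3 := supp_subset_iff.1 hβ'.1 j hjF
        have h4 : βbar j = 0 := notMem_supp.1 hjG
        simp [h3, h4]
    have h3 : ∀ j ∈ D, -(m / 4 * (β' - βbar) j ^ 2 + Γ ^ 2 / m)
        ≤ gradient Q βbar j * (β' - βbar) j := by
      intro j _
      have h4 := abs_gradient_le_gradSup Q βbar j
      set x := (β' - βbar) j
      set γ := gradient Q βbar j
      have h5 : γ ^ 2 ≤ Γ ^ 2 := by
        rw [← sq_abs]
        exact pow_le_pow_left₀ (abs_nonneg _) h4 2
      have h6 : γ * x + m / 4 * x ^ 2 + Γ ^ 2 / m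
          = ((γ + m / 2 * x) ^ 2 + (Γ ^ 2 - γ ^ 2)) / m := by
        field_simp; ring
      have : 0 ≤ ((γ + m / 2 * x) ^ 2 + (Γ ^ 2 - γ ^ 2)) / m := by
        have := sq_nonneg (γ + m / 2 * x)
        exact div_nonneg (by linarith) hm.le
      linarith
    have h4 := Finset.sum_le_sum h3
    rw [Finset.sum_neg_distrib, Finset.sum_add_distrib, ← Finset.mul_sum, Finset.sum_const,
      nsmul_eq_mul] at h4
    rw [h2] at h1
    have h5 : m / 4 * ∑ j ∈ D, (β' - βbar) j ^ 2 ≤ m / 4 * ‖β' - βbar‖ ^ 2 := by gcongr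
    have h6 : m / 4 * ‖β' - βbar‖ ^ 2 ≤ D.card * (Γ ^ 2 / m) := by linarith
    have h7 : m ^ 2 * ‖β' - βbar‖ ^ 2 ≤ 4 * (D.card * Γ ^ 2) := by
      have h8 : D.card * (Γ ^ 2 / m) * (4 * m) = 4 * (D.card * Γ ^ 2) := by field_simp
      nlinarith
    have hD0 : D.card = 0 := by
      by_contra hne
      have hpos : (0 : ℝ) < D.card := by exact_mod_cast Nat.pos_of_ne_zero hne
      have h8 : m ^ 2 * (D.card * g) ≤ m ^ 2 * (L * ‖β' - βbar‖ ^ 2) := by gcongr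
      have h9 : L * (m ^ 2 * ‖β' - βbar‖ ^ 2) ≤ L * (4 * (D.card * Γ ^ 2)) := by gcongr
      have h10 : D.card * (4 * L * Γ ^ 2) < D.card * (δ₀ * m ^ 2) := by gcongr
      have h11 : D.card * (δ₀ * m ^ 2) ≤ D.card * (g * m ^ 2) := by gcongr
      nlinarith
    rw [hD0]
    simp only [Nat.cast_zero]
    positivity
  · obtain ⟨βE, hβE⟩ := h.exists_restrictedMin hEcard
    obtain ⟨ha1, ha2⟩ := h.lower_of_restrictedMin hβE hEcard hβ's hsub'
    obtain ⟨hb1, _⟩ := h.lower_of_restrictedMin hβE hEcard hbars hsubbar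
    set a := ‖β' - βE‖ with ha
    set b := ‖βbar - βE‖ with hb
    have ha0 : 0 ≤ a := norm_nonneg _
    have hba : b ≤ Real.sqrt κ * a := by
      refine (sq_le_sq₀ (norm_nonneg _) (by positivity)).1 ?_
      rw [mul_pow, Real.sq_sqrt hκ]
      have h1 : U / 2 * a ^ 2 ≤ κ * m / 2 * a ^ 2 := by gcongr
      have h2 : m / 2 * b ^ 2 ≤ m / 2 * (κ * a ^ 2) := by linarith
      exact le_of_mul_le_mul_left h2 (by positivity)
    have hdist : ‖β' - βbar‖ ≤ (1 + Real.sqrt κ) * a := by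
      have h1 : ‖β' - βbar‖ ≤ a + b := by
        rw [ha, hb, norm_sub_rev βbar βE]
        exact norm_sub_le_norm_sub_add_norm_sub _ _ _
      linarith
    have hFE : F ⊆ E := (Finset.subset_insert i F).trans Finset.subset_union_left
    have h1 := h.sub_le_of_gradient_sq_le hβ hFE hEcard (hβE.mem_sublevel hEcard) hβE.1 hgrad
    have h2 : ((E \ F).card : ℝ) ≤ kbar + 1 := by
      have h3 : E \ F ⊆ insert i G := by
        intro j hj
        simp only [hE, hF₁, Finset.mem_sdiff, Finset.mem_union, Finset.mem_insert] at hj ⊢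
        tauto
      have h4 := (Finset.card_le_card h3).trans (Finset.card_insert_le _ _)
      exact_mod_cast h4.trans (Nat.add_le_add_right hGcard 1)
    have h3 : m / 2 * a ^ 2 ≤ (kbar + 1) * (2 * L * g) / (2 * m) := by
      have h4 : ((E \ F).card : ℝ) * (2 * L * g) / (2 * m)
          ≤ (kbar + 1) * (2 * L * g) / (2 * m) := by gcongr
      linarith
    have h4 : m ^ 2 * a ^ 2 ≤ 2 * (kbar + 1) * L * g := by
      rw [le_div_iff₀ (by positivity)] at h3
      nlinarith
    have h5 : D.card * g ≤ L * ((1 + Real.sqrt κ) * a) ^ 2 :=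
      hDg.trans (mul_le_mul_of_nonneg_left (pow_le_pow_left₀ (norm_nonneg _) hdist 2) hL0)
    have h6 : L * L ≤ κ * m * (κ * m) := mul_le_mul hL hL hL0 (by positivity)
    have h7 : m ^ 2 * (D.card * g)
        ≤ m ^ 2 * (2 * (kbar + 1) * ((1 + Real.sqrt κ) ^ 2 * κ ^ 2) * g) := by
      calc m ^ 2 * (D.card * g) ≤ m ^ 2 * (L * ((1 + Real.sqrt κ) * a) ^ 2) := by gcongr
        _ = L * (1 + Real.sqrt κ) ^ 2 * (m ^ 2 * a ^ 2) := by ring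
        _ ≤ L * (1 + Real.sqrt κ) ^ 2 * (2 * (kbar + 1) * L * g) := by gcongr
        _ = (1 + Real.sqrt κ) ^ 2 * (2 * (kbar + 1) * g) * (L * L) := by ring
        _ ≤ (1 + Real.sqrt κ) ^ 2 * (2 * (kbar + 1) * g) * (κ * m * (κ * m)) := by gcongr
        _ = _ := by ring
    exact le_of_mul_le_mul_right (le_of_mul_le_mul_left h7 (by positivity)) hg0

end Regular

end Counting

/-! ### Runs of the algorithm -/

/-- The hypotheses on the objective, the comparison vector and the threshold under which the
algorithm is analysed. -/
structure GreedySetting {d : ℕ} (Q : Vec d → ℝ) (s : ℕ) (m U L κ : ℝ) (kbar : ℕ) (βbar : Vec d)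
    (v : Variant) (τ δ₀ : ℝ) : Prop where
  reg : Regular Q s m U L
  U_le : U ≤ κ * m
  L_le : L ≤ κ * m
  budget : levelBound κ kbar + 1 + kbar ≤ s
  l0_le : l0 βbar ≤ kbar
  isMin : IsRestrictedMin Q (supp βbar) βbar
  τ_pos : 0 < τ
  δ_pos : 0 < δ₀
  noise : 4 * L * gradSup Q βbar ^ 2 < δ₀ * m ^ 2
  gain : GainThreshold L τ δ₀ v

/-- The invariant of the run. In the inner loop the number of features can exceed `levelBound` by
one, but only right after a forward step, before any removal. -/
structure RunInvariant {d : ℕ} (Q : Vec d → ℝ) (L κ : ℝ) (kbar : ℕ) (δ₀ : ℝ) (σ : State d) :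
    Prop where
  isMin : IsRestrictedMin Q σ.F σ.β
  card : σ.k = σ.F.card
  gain_ge : ∀ j, 1 ≤ j → j ≤ σ.k → δ₀ ≤ σ.gain j
  sum_gain_le : ∑ j ∈ Finset.Icc 1 σ.k, σ.gain j ≤ Q 0 - Q σ.β
  outer : σ.phase ≠ .inner → (σ.k : ℝ) ≤ levelBound κ kbar
  inner_le : (σ.k : ℝ) ≤ levelBound κ kbar + 1
  inner : (σ.k : ℝ) ≤ levelBound κ kbar ∨ ∃ F i β, σ.F = insert i F ∧
    IsRestrictedMin Q F β ∧ σ.gain σ.k = Q β - Q σ.β ∧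
      ∀ j, j ∉ F → gradient Q β j ^ 2 ≤ 2 * L * σ.gain σ.k

section Runs

variable {d : ℕ} {Q : Vec d → ℝ} {s : ℕ} {m U L κ : ℝ} {kbar : ℕ} {βbar : Vec d}
  {v : Variant} {τ δ₀ : ℝ}

theorem levelBound_nonneg (κ : ℝ) (kbar : ℕ) : 0 ≤ levelBound κ kbar := by
  unfold levelBound; positivity

theorem runInvariant_initState (Q : Vec d → ℝ) (L κ : ℝ) (kbar : ℕ) (δ₀ : ℝ) :
    RunInvariant Q L κ kbar δ₀ (initState d) where
  isMin := by
    refine ⟨by simp [initState, supp_zero], fun β' h => ?_⟩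
    have : β' = 0 := by
      ext j
      exact supp_subset_iff.1 h j (by simp [initState])
    rw [this]; rfl
  card := by simp [initState]
  gain_ge := by
    intro j h1 h2
    simp only [initState] at h2
    omega
  sum_gain_le := by simp [initState]
  outer := fun _ => by simpa [initState] using levelBound_nonneg κ kbar
  inner_le := by
    have := levelBound_nonneg κ kbar
    simp only [initState, Nat.cast_zero]
    linarith
  inner := Or.inl (by simpa [initState] using levelBound_nonneg κ kbar)

theorem RunInvariant.card_le (hS : GreedySetting Q s m U L κ kbar βbar v τ δ₀) {σ : State d}
    (h : RunInvariant Q L κ kbar δ₀ σ) : σ.F.card + kbar ≤ s := by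
  have h1 := h.inner_le
  have h2 := hS.budget
  rw [h.card] at h1
  have : (σ.F.card : ℝ) + kbar ≤ s := by linarith
  exact_mod_cast this

theorem RunInvariant.card_succ_le (hS : GreedySetting Q s m U L κ kbar βbar v τ δ₀)
    {k : ℕ} {F : Finset (Fin d)} {β : Vec d} {g : ℕ → ℝ}
    (h : RunInvariant Q L κ kbar δ₀ ⟨.outer, k, F, β, g⟩) : F.card + 1 ≤ s := by
  have h1 := h.outer (by simp)
  have h2 := hS.budget
  have h3 := h.card
  simp only at h1 h3
  rw [h3] at h1
  have h0 : (0 : ℝ) ≤ kbar := Nat.cast_nonneg _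
  have : (F.card : ℝ) + 1 ≤ s := by linarith
  exact_mod_cast this

theorem RunInvariant.step (hS : GreedySetting Q s m U L κ kbar βbar v τ δ₀) {σ σ' : State d}
    (hstep : Step Q v τ σ σ') (h : RunInvariant Q L κ kbar δ₀ σ) :
    RunInvariant Q L κ kbar δ₀ σ' := by
  cases hstep with
  | finish k F β g htest =>
    have hk := h.outer (by simp)
    exact ⟨h.isMin, h.card, h.gain_ge, h.sum_gain_le, fun _ => hk, h.inner_le, Or.inl hk⟩
  | forward k F β g i β' htest hi hβ' =>
    obtain ⟨hiF, hgrad, hgain⟩ :=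
      hS.reg.forward_gain hS.τ_pos hS.gain (h.card_succ_le hS) h.isMin htest hi hβ'
    have hk := h.outer (by simp)
    have hsum := h.sum_gain_le
    have hcard := h.card
    have hge := h.gain_ge
    simp only at hk hsum hcard hge
    refine ⟨hβ', by simp [Finset.card_insert_of_notMem hiF, hcard], ?_, ?_, by simp, ?_, ?_⟩
    · intro j h1 h2
      simp only at h2 ⊢
      rcases eq_or_ne j (k + 1) with rfl | hne
      · simpa using hgain
      · rw [Function.update_of_ne hne]
        exact hge j h1 (by omega)
    · simp only
      rw [Finset.sum_Icc_succ_top (by omega), Function.update_self]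
      have : ∑ j ∈ Finset.Icc 1 k, Function.update g (k + 1) (Q β - Q β') j
          = ∑ j ∈ Finset.Icc 1 k, g j := by
        refine Finset.sum_congr rfl fun j hj => Function.update_of_ne ?_ _ _
        have := (Finset.mem_Icc.1 hj).2
        omega
      rw [this]
      linarith
    · push_cast
      linarith
    · exact Or.inr ⟨F, i, β, rfl, h.isMin, by simp, by simpa using hgrad⟩
  | leave k F β g hleave =>
    have hk : (k : ℝ) ≤ levelBound κ kbar := by
      rcases h.inner with hk | ⟨F₀, i, β₀, rfl, hβ₀, hg, hgrad⟩
      · exact hk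
      · have hcard := h.card
        simp only at hcard hg hgrad
        rw [hcard]
        have hk1 : 1 ≤ k := by
          rw [hcard]
          exact Finset.card_pos.2 (Finset.insert_nonempty _ _)
        exact hS.reg.card_le_levelBound hS.U_le hS.L_le hS.l0_le hS.isMin hS.δ_pos hS.noise
          (h.card_le hS) hβ₀ h.isMin hg (h.gain_ge k hk1 le_rfl) hgrad hleave
    exact ⟨h.isMin, h.card, h.gain_ge, h.sum_gain_le, fun _ => hk, h.inner_le, Or.inl hk⟩
  | backward k F β g i β' hi hmin hlt hβ' =>
    have hcard := h.card
    have hsum := h.sum_gain_le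
    have hge := h.gain_ge
    have hle := h.inner_le
    simp only at hcard hsum hge hle
    obtain ⟨k, rfl⟩ : ∃ k', k = k' + 1 :=
      Nat.exists_eq_succ_of_ne_zero (by rw [hcard]; exact (Finset.card_pos.2 ⟨i, hi⟩).ne')
    push_cast at hle
    have hk : ((k + 1 - 1 : ℕ) : ℝ) ≤ levelBound κ kbar := by
      rw [Nat.add_sub_cancel]; linarith
    have hg := hge (k + 1) (by omega) le_rfl
    have hδ := hS.δ_pos
    refine ⟨hβ', ?_, ?_, ?_, fun _ => hk, ?_, Or.inl hk⟩
    · simp only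
      rw [Finset.card_erase_of_mem hi, hcard]
    · intro j h1 h2
      simp only at h2 ⊢
      exact hge j h1 (by omega)
    · simp only [Nat.add_sub_cancel]
      rw [Finset.sum_Icc_succ_top (by omega)] at hsum
      have := hβ'.2 _ (supp_move_neg_subset h.isMin.1 i)
      linarith
    · simp only
      linarith

/-- The order of the control points within one round of the termination measure. -/
def Phase.rank : Phase → ℕ
  | .halted => 0
  | .outer => 1
  | .inner => 2

/-- The surplus `Q 0 - Q β^(k) - ∑_{j ≤ k} δ^(j)`: unchanged by a forward step, and raised by at
least `δ^(k) / 2` by a removal. -/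
noncomputable def surplus (Q : Vec d → ℝ) (σ : State d) : ℝ :=
  Q 0 - Q σ.β - ∑ j ∈ Finset.Icc 1 σ.k, σ.gain j

/-- A natural number that decreases in every step, where `B` is an upper bound for the surplus.
The weight `3` of the number of possible removals pays for the feature that becomes
available again. -/
noncomputable def runMeasure (Q : Vec d → ℝ) (B δ₀ : ℝ) (σ : State d) : ℕ :=
  3 * ⌊2 * (B - surplus Q σ) / δ₀⌋₊ + 2 * (d - σ.k) + σ.phase.rank

theorem RunInvariant.surplus_le (hS : GreedySetting Q s m U L κ kbar βbar v τ δ₀) {σ : State d}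
    (h : RunInvariant Q L κ kbar δ₀ σ) :
    surplus Q σ ≤ ‖gradient Q 0‖ ^ 2 / (2 * m) := by
  have h1 := hS.reg.sub_le (h.isMin.mem_sublevel ((Nat.le_add_right _ _).trans (h.card_le hS)))
  have h2 : 0 ≤ ∑ j ∈ Finset.Icc 1 σ.k, σ.gain j := by
    refine Finset.sum_nonneg fun j hj => ?_
    rw [Finset.mem_Icc] at hj
    exact hS.δ_pos.le.trans (h.gain_ge j hj.1 hj.2)
  rw [surplus]
  linarith

theorem RunInvariant.runMeasure_lt (hS : GreedySetting Q s m U L κ kbar βbar v τ δ₀)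
    {σ σ' : State d} (hstep : Step Q v τ σ σ') (h : RunInvariant Q L κ kbar δ₀ σ) :
    runMeasure Q (‖gradient Q 0‖ ^ 2 / (2 * m)) δ₀ σ'
      < runMeasure Q (‖gradient Q 0‖ ^ 2 / (2 * m)) δ₀ σ := by
  have h' := h.step hS hstep
  have hB := h'.surplus_le hS
  have hkd : σ'.k ≤ d := by
    rw [h'.card]
    exact (Finset.card_le_univ _).trans (by simp)
  cases hstep with
  | finish k F β g htest => simp [runMeasure, surplus, Phase.rank]
  | leave k F β g hleave => simp [runMeasure, surplus, Phase.rank]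
  | forward k F β g i β' htest hi hβ' =>
    have hs : surplus Q ⟨.inner, k + 1, insert i F, β', Function.update g (k + 1) (Q β - Q β')⟩
        = surplus Q ⟨.outer, k, F, β, g⟩ := by
      simp only [surplus]
      rw [Finset.sum_Icc_succ_top (by omega), Function.update_self]
      have : ∑ j ∈ Finset.Icc 1 k, Function.update g (k + 1) (Q β - Q β') j
          = ∑ j ∈ Finset.Icc 1 k, g j := by
        refine Finset.sum_congr rfl fun j hj => Function.update_of_ne ?_ _ _
        have := (Finset.mem_Icc.1 hj).2
        omega
      rw [this]
      ring
    simp only at hkd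
    simp only [runMeasure, hs, Phase.rank]
    omega
  | backward k F β g i β' hi hmin hlt hβ' =>
    have hcard := h.card
    have hge := h.gain_ge
    simp only at hcard hge
    obtain ⟨k, rfl⟩ : ∃ k', k = k' + 1 :=
      Nat.exists_eq_succ_of_ne_zero (by rw [hcard]; exact (Finset.card_pos.2 ⟨i, hi⟩).ne')
    have hg := hge (k + 1) (by omega) le_rfl
    have hδ := hS.δ_pos
    have hs : surplus Q ⟨.inner, k + 1, F, β, g⟩ + δ₀ / 2
        ≤ surplus Q ⟨.inner, k + 1 - 1, F.erase i, β', g⟩ := by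
      simp only [surplus, Nat.add_sub_cancel]
      rw [Finset.sum_Icc_succ_top (by omega)]
      have := hβ'.2 _ (supp_move_neg_subset h.isMin.1 i)
      linarith
    set B := ‖gradient Q 0‖ ^ 2 / (2 * m)
    set x := surplus Q ⟨.inner, k + 1, F, β, g⟩
    set y := surplus Q ⟨.inner, k + 1 - 1, F.erase i, β', g⟩
    have hfloor : ⌊2 * (B - y) / δ₀⌋₊ + 1 ≤ ⌊2 * (B - x) / δ₀⌋₊ := by
      rw [← Nat.floor_add_one (div_nonneg (by linarith) hδ.le)]
      refine Nat.floor_mono ?_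
      rw [div_add_one hδ.ne']
      exact div_le_div_of_nonneg_right (by linarith) hδ.le
    simp only [Nat.add_sub_cancel] at hkd
    simp only [runMeasure, Phase.rank, Nat.add_sub_cancel]
    change 3 * ⌊2 * (B - y) / δ₀⌋₊ + _ + _ < 3 * ⌊2 * (B - x) / δ₀⌋₊ + _ + _
    have hk : k + 1 ≤ d := by
      rw [hcard]
      exact (Finset.card_le_univ _).trans (by simp)
    omega

theorem RunInvariant.of_reachable (hS : GreedySetting Q s m U L κ kbar βbar v τ δ₀) {σ : State d}
    (h : Relation.ReflTransGen (Step Q v τ) (initState d) σ) :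
    RunInvariant Q L κ kbar δ₀ σ := by
  induction h with
  | refl => exact runInvariant_initState Q L κ kbar δ₀
  | tail _ hstep ih => exact ih.step hS hstep

theorem GreedySetting.exists_selects (hS : GreedySetting Q s m U L κ kbar βbar v τ δ₀)
    {F : Finset (Fin d)} {β : Vec d} (hβ : IsRestrictedMin Q F β) (hF : F.card + 1 ≤ s)
    (htest : ¬ Stop Q τ F β v) : ∃ i, Selects Q F β i v := by
  classical
  obtain ⟨j₀, hj₀, -⟩ := exists_notMem_of_test_fails hS.reg.diff hβ hS.τ_pos htest
  have hne : (Finset.univ \ F).Nonempty := ⟨j₀, by simpa using hj₀⟩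
  have hQ0 : Q β ≤ Q 0 := hβ.2 0 (by simp [supp_zero])
  cases v with
  | obj =>
    choose a ha using fun j => hS.reg.exists_move_min hQ0 j (l0_move_le hβ.1 hF j)
    obtain ⟨i, hi, hmin⟩ := Finset.exists_min_image _ (fun j => Q (move β j (a j))) hne
    exact ⟨i, (Finset.mem_sdiff.1 hi).2, a i, fun j hj b =>
      (hmin j (by simpa using hj)).trans (ha j b)⟩
  | gdt =>
    obtain ⟨i, hi, hmax⟩ := Finset.exists_max_image _ (fun j => |gradient Q β j|) hne
    exact ⟨i, (Finset.mem_sdiff.1 hi).2, fun j hj => hmax j (by simpa using hj)⟩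

/-- No reachable state other than a halted one is stuck: all minima are attained. -/
theorem GreedySetting.exists_step (hS : GreedySetting Q s m U L κ kbar βbar v τ δ₀) {σ : State d}
    (h : RunInvariant Q L κ kbar δ₀ σ) (hphase : σ.phase ≠ .halted) :
    ∃ σ', Step Q v τ σ σ' := by
  classical
  obtain ⟨phase, k, F, β, g⟩ := σ
  cases phase with
  | halted => exact absurd rfl hphase
  | outer =>
    by_cases htest : Stop Q τ F β v
    · exact ⟨_, Step.finish k F β g htest⟩
    · have hF := h.card_succ_le hS
      obtain ⟨i, hi⟩ := hS.exists_selects h.isMin hF htest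
      obtain ⟨β', hβ'⟩ := hS.reg.exists_restrictedMin ((Finset.card_insert_le i F).trans hF)
      exact ⟨_, Step.forward k F β g i β' htest hi hβ'⟩
  | inner =>
    by_cases hleave : ∀ i ∈ F, g k / 2 ≤ Q (move β i (-β i)) - Q β
    · exact ⟨_, Step.leave k F β g hleave⟩
    · push Not at hleave
      obtain ⟨i₀, hi₀, hlt₀⟩ := hleave
      obtain ⟨i, hi, hmin⟩ := Finset.exists_min_image F (fun j => Q (move β j (-β j))) ⟨i₀, hi₀⟩
      have hF : (F.erase i).card ≤ s :=
        (Finset.card_le_card (Finset.erase_subset _ _)).trans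
          ((Nat.le_add_right _ _).trans (h.card_le hS))
      obtain ⟨β', hβ'⟩ := hS.reg.exists_restrictedMin hF
      have := hmin i₀ hi₀
      exact ⟨_, Step.backward k F β g i β' hi hmin (by linarith) hβ'⟩

theorem GreedySetting.terminatesWithin (hS : GreedySetting Q s m U L κ kbar βbar v τ δ₀) {M : ℝ}
    (hM : levelBound κ kbar ≤ M) : TerminatesWithin Q v τ M := by
  refine ⟨?_, fun σ hσ hstuck => ?_⟩
  · rintro ⟨run, h0, hrun⟩
    have hinv : ∀ t, RunInvariant Q L κ kbar δ₀ (run t) := by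
      intro t
      induction t with
      | zero => rw [h0]; exact runInvariant_initState Q L κ kbar δ₀
      | succ t ih => exact ih.step hS (hrun t)
    set w := fun t => runMeasure Q (‖gradient Q 0‖ ^ 2 / (2 * m)) δ₀ (run t) with hw
    have hdec : ∀ t, w (t + 1) < w t := fun t => (hinv t).runMeasure_lt hS (hrun t)
    have hle : ∀ t, w t + t ≤ w 0 := by
      intro t
      induction t with
      | zero => simp
      | succ t ih => have := hdec t; omega
    have := hle (w 0 + 1)
    omega
  · have hinv := RunInvariant.of_reachable hS hσ
    have hphase : σ.phase = .halted := by
      by_contra hne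
      obtain ⟨σ', hσ'⟩ := hS.exists_step hinv hne
      exact hstuck σ' hσ'
    exact ⟨hphase, (hinv.outer (by simp [hphase])).trans hM⟩

/-- Without coordinates the stopping test succeeds at once. -/
theorem terminatesWithin_dim_zero (Q : Vec 0 → ℝ) (v : Variant) (τ : ℝ) {M : ℝ} (hM : 0 ≤ M) :
    TerminatesWithin Q v τ M := by
  have hstep : ∀ σ σ' : State 0, σ.phase ≠ .inner → Step Q v τ σ σ' →
      σ'.phase = .halted ∧ σ'.k = σ.k := by
    intro σ σ' hσ h
    cases h with
    | finish => exact ⟨rfl, rfl⟩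
    | forward _ _ _ _ i => exact i.elim0
    | leave => exact absurd rfl hσ
    | backward => exact absurd rfl hσ
  refine ⟨?_, fun σ hσ hstuck => ?_⟩
  · rintro ⟨run, h0, hrun⟩
    have h1 := (hstep _ _ (by simp [h0, initState]) (hrun 0)).1
    have h2 := hrun 1
    generalize run (0 + 1) = σ at h1 h2
    generalize run (1 + 1) = σ' at h2
    cases h2 <;> simp at h1
  · have hinv : σ.phase ≠ .inner ∧ σ.k = 0 := by
      clear hstuck
      induction hσ with
      | refl => simp [initState]
      | tail _ h ih =>
        obtain ⟨h1, h2⟩ := hstep _ _ ih.1 h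
        exact ⟨by simp [h1], h2.trans ih.2⟩
    obtain ⟨phase, k, F, β, g⟩ := σ
    cases phase with
    | halted => exact ⟨rfl, by simpa [show k = 0 from hinv.2] using hM⟩
    | inner => exact absurd rfl hinv.1
    | outer =>
      refine absurd (Step.finish k F β g ?_) (hstuck _)
      cases v
      · exact fun j => j.elim0
      · exact fun j => j.elim0

end Runs

/-! ### Restricted strong convexity from restricted isometry and curvature bounds -/

section Curvature

theorem half_le_of_second_deriv_ge {φ φ' φ'' : ℝ → ℝ} (h1 : ∀ t, HasDerivAt φ (φ' t) t)
    (h2 : ∀ t, HasDerivAt φ' (φ'' t) t) {a : ℝ} (ha : ∀ t ∈ Set.Icc (0 : ℝ) 1, a ≤ φ'' t) :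
    a / 2 ≤ φ 1 - φ 0 - φ' 0 := by
  have hd1 : ∀ t, HasDerivAt (fun t => φ' t - a * t) (φ'' t - a) t := fun t =>
    ((h2 t).fun_sub ((hasDerivAt_id' t).const_mul a)).congr_deriv (by ring)
  have hm1 : MonotoneOn (fun t => φ' t - a * t) (Set.Icc 0 1) := by
    refine monotoneOn_of_deriv_nonneg (convex_Icc 0 1)
      (fun t _ => (hd1 t).continuousAt.continuousWithinAt)
      (fun t _ => (hd1 t).differentiableAt.differentiableWithinAt) fun t ht => ?_
    rw [(hd1 t).deriv]
    linarith [ha t (interior_subset ht)]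
  have hd2 : ∀ t, HasDerivAt (fun t => φ t - φ' 0 * t - a / 2 * t ^ 2) (φ' t - φ' 0 - a * t) t :=
    fun t => (((h1 t).fun_sub ((hasDerivAt_id' t).const_mul (φ' 0))).fun_sub
      (((hasDerivAt_id' t).fun_pow 2).const_mul (a / 2))).congr_deriv (by simp; ring)
  have hm2 : MonotoneOn (fun t => φ t - φ' 0 * t - a / 2 * t ^ 2) (Set.Icc 0 1) := by
    refine monotoneOn_of_deriv_nonneg (convex_Icc 0 1)
      (fun t _ => (hd2 t).continuousAt.continuousWithinAt)
      (fun t _ => (hd2 t).differentiableAt.differentiableWithinAt) fun t ht => ?_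
    rw [(hd2 t).deriv]
    have ht' := interior_subset ht
    have := hm1 (Set.left_mem_Icc.2 zero_le_one) ht' ht'.1
    simp only at this
    linarith
  have := hm2 (Set.left_mem_Icc.2 zero_le_one) (Set.right_mem_Icc.2 zero_le_one) zero_le_one
  simp only at this
  linarith

theorem second_deriv_le_half {φ φ' φ'' : ℝ → ℝ} (h1 : ∀ t, HasDerivAt φ (φ' t) t)
    (h2 : ∀ t, HasDerivAt φ' (φ'' t) t) {b : ℝ} (hb : ∀ t ∈ Set.Icc (0 : ℝ) 1, φ'' t ≤ b) :
    φ 1 - φ 0 - φ' 0 ≤ b / 2 := by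
  have := half_le_of_second_deriv_ge (fun t => (h1 t).neg) (fun t => (h2 t).neg) (a := -b)
    fun t ht => neg_le_neg (hb t ht)
  simp only [Pi.neg_apply] at this
  linarith

variable {n d s : ℕ} {l : Fin n → ℝ → ℝ → ℝ} {R : Vec d → ℝ} {X : Matrix (Fin n) (Fin d) ℝ}
  {y : Fin n → ℝ} {lamMinus lamPlus lamRMinus lamRPlus : ℝ}

theorem mulVec_add_smul (X : Matrix (Fin n) (Fin d) ℝ) (β Δ : Vec d) (t : ℝ) (i : Fin n) :
    X.mulVec (β + t • Δ).ofLp i = X.mulVec β.ofLp i + t * X.mulVec Δ.ofLp i := by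
  simp [Matrix.mulVec_add, Matrix.mulVec_smul]

theorem differentiable_objective (hl : ∀ i v, Differentiable ℝ fun u => l i u v)
    (hR : Differentiable ℝ R) : Differentiable ℝ (objective l R X y) := by
  unfold objective
  refine Differentiable.add (Differentiable.const_mul (Differentiable.fun_sum fun i _ => ?_) _) hR
  have : Differentiable ℝ fun β : Vec d => X.mulVec β.ofLp i := by
    unfold Matrix.mulVec dotProduct
    fun_prop
  exact (hl i (y i)).comp this

/-- A point of the sublevel set can be moved to the origin inside the sublevel set, so every value
between `X_i β` and `X_i β'` is of the form `X_i γ` with `γ` in the sublevel set. The bound on the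
second derivative of the losses therefore extends to the segment from `β` to `β'`, although the
points of this segment may have more than `s` nonzero entries. -/
theorem CurvatureBounds.loss_segment
    (hconv : ConvexOn ℝ Set.univ (objective l R X y))
    (hC : CurvatureBounds l R X y s lamMinus lamPlus lamRMinus lamRPlus) {β β' : Vec d}
    (hβ : β ∈ sublevel (objective l R X y) s) (hβ' : β' ∈ sublevel (objective l R X y) s)
    (i : Fin n) {t : ℝ} (ht : t ∈ Set.Icc (0 : ℝ) 1) :
    lamMinus ≤ deriv (deriv fun u => l i u (y i))
        (X.mulVec β.ofLp i + t * X.mulVec (β' - β).ofLp i) ∧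
      deriv (deriv fun u => l i u (y i))
        (X.mulVec β.ofLp i + t * X.mulVec (β' - β).ofLp i) ≤ lamPlus := by
  have hscale : ∀ γ ∈ sublevel (objective l R X y) s, ∀ r ∈ Set.Icc (0 : ℝ) 1,
      r • γ ∈ sublevel (objective l R X y) s := by
    intro γ hγ r hr
    refine ⟨(Finset.card_le_card (supp_smul_subset r γ)).trans hγ.1, ?_⟩
    have h1 := hconv.2 (Set.mem_univ (0 : Vec d)) (Set.mem_univ γ) (sub_nonneg.2 hr.2) hr.1
      (by ring)
    simp only [smul_zero, zero_add, smul_eq_mul] at h1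
    have h2 := mul_le_mul_of_nonneg_left hγ.2 hr.1
    linarith
  have hreach : ∀ γ ∈ sublevel (objective l R X y) s, ∀ u ∈ Set.uIcc 0 (X.mulVec γ.ofLp i),
      lamMinus ≤ deriv (deriv fun u => l i u (y i)) u ∧
        deriv (deriv fun u => l i u (y i)) u ≤ lamPlus := by
    intro γ hγ u hu
    rw [← segment_eq_uIcc, segment_eq_image'] at hu
    obtain ⟨r, hr, rfl⟩ := hu
    have h1 := hC.loss _ (hscale γ hγ r hr) i
    have h2 : X.mulVec (r • γ).ofLp i = 0 + r • (X.mulVec γ.ofLp i - 0) := by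
      simp [Matrix.mulVec_smul]
    rwa [h2] at h1
  have hmem : X.mulVec β.ofLp i + t * X.mulVec (β' - β).ofLp i
      ∈ Set.uIcc (X.mulVec β.ofLp i) (X.mulVec β'.ofLp i) := by
    rw [← segment_eq_uIcc, segment_eq_image']
    exact ⟨t, ht, by simp [Matrix.mulVec_sub]⟩
  rcases Set.uIcc_subset_uIcc_union_uIcc (b := 0) hmem with h | h
  · exact hreach β hβ _ (by rwa [Set.uIcc_comm])
  · exact hreach β' hβ' _ h

/-- Second-order expansion of `Q` along the segment from `β` to `β'`. The losses contribute their
second derivatives weighted by `(X_i (β' - β))² / n`, and these weights sum to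
`gramForm X (β' - β)`. -/
theorem bregman_bounds (hn : 0 < n) (hl : ∀ i v, Differentiable ℝ fun u => l i u v)
    (hl' : ∀ i v, Differentiable ℝ (deriv fun u => l i u v))
    (hR : Differentiable ℝ R) (hR' : Differentiable ℝ (fderiv ℝ R))
    (hm0 : 0 ≤ lamMinus) (hp0 : 0 < lamPlus) (hX : RestrictedIsometry X s)
    (hconv : ConvexOn ℝ Set.univ (objective l R X y))
    (hC : CurvatureBounds l R X y s lamMinus lamPlus lamRMinus lamRPlus) {β β' : Vec d}
    (hβ : β ∈ sublevel (objective l R X y) s) (hβ' : β' ∈ sublevel (objective l R X y) s)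
    (hs : l0 (β' - β) ≤ s) :
    (lamRMinus + 0.5 * lamMinus) / 2 * ‖β' - β‖ ^ 2 ≤ bregman (objective l R X y) β β' ∧
      bregman (objective l R X y) β β' ≤ (lamRPlus + 1.4 * lamPlus) / 2 * ‖β' - β‖ ^ 2 := by
  set Q := objective l R X y with hQ
  set Δ := β' - β with hΔ
  set a : Fin n → ℝ := fun i => X.mulVec β.ofLp i with ha
  set c : Fin n → ℝ := fun i => X.mulVec Δ.ofLp i with hc
  have hline : ∀ t : ℝ, HasDerivAt (fun t : ℝ => β + t • Δ) Δ t := fun t => by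
    simpa using ((hasDerivAt_id t).smul_const Δ).const_add β
  have hac : ∀ i t, HasDerivAt (fun t : ℝ => a i + t * c i) (c i) t := fun i t => by
    simpa using ((hasDerivAt_id t).mul_const (c i)).const_add (a i)
  set φ : ℝ → ℝ := fun t => Q (β + t • Δ) with hφ
  set φ' : ℝ → ℝ := fun t => 1 / (n : ℝ) * ∑ i, deriv (fun u => l i u (y i)) (a i + t * c i) * c i
    + fderiv ℝ R (β + t • Δ) Δ with hφ'
  set φ'' : ℝ → ℝ := fun t =>
    1 / (n : ℝ) * ∑ i, deriv (deriv fun u => l i u (y i)) (a i + t * c i) * c i * c i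
    + fderiv ℝ (fderiv ℝ R) (β + t • Δ) Δ Δ with hφ''
  have h1 : ∀ t, HasDerivAt φ (φ' t) t := by
    intro t
    have e : φ = fun t => 1 / (n : ℝ) * ∑ i, l i (a i + t * c i) (y i) + R (β + t • Δ) := by
      funext t
      simp only [hφ, hQ, objective, mulVec_add_smul, ha, hc]
    rw [e]
    refine HasDerivAt.add (HasDerivAt.const_mul _ (HasDerivAt.fun_sum fun i _ => ?_)) ?_
    · exact ((hl i (y i)) (a i + t * c i)).hasDerivAt.comp t (hac i t)
    · exact (hR (β + t • Δ)).hasFDerivAt.comp_hasDerivAt t (hline t)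
  have h2 : ∀ t, HasDerivAt φ' (φ'' t) t := by
    intro t
    refine HasDerivAt.add (HasDerivAt.const_mul _ (HasDerivAt.fun_sum fun i _ => ?_)) ?_
    · exact HasDerivAt.mul_const (((hl' i (y i)) (a i + t * c i)).hasDerivAt.comp t (hac i t)) _
    · have h3 := (hR' (β + t • Δ)).hasFDerivAt.comp_hasDerivAt t (hline t)
      exact ((ContinuousLinearMap.apply ℝ ℝ Δ).hasFDerivAt.comp_hasDerivAt t h3)
  have hbreg : bregman Q β β' = φ 1 - φ 0 - φ' 0 := by
    have hd : Differentiable ℝ Q := differentiable_objective hl hR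
    have h3 : HasDerivAt φ (inner ℝ (gradient Q β) Δ) 0 := by
      have h4 : HasGradientAt Q (gradient Q β) (β + (0 : ℝ) • Δ) := by
        simpa using (hd β).hasGradientAt
      have h5 := h4.hasFDerivAt.comp_hasDerivAt (0 : ℝ) (hline 0)
      rw [InnerProductSpace.toDual_apply_apply] at h5
      exact h5
    rw [bregman, ← hΔ, h3.unique (h1 0)]
    simp [hφ, hΔ]
  have hn' : (0 : ℝ) < n := by exact_mod_cast hn
  have hgram : gramForm X Δ = 1 / (n : ℝ) * ∑ i, c i * c i := by
    simp only [gramForm, hc, sq]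
  obtain ⟨hX1, hX2⟩ := hX Δ hs
  rw [hgram] at hX1 hX2
  have hseg : ∀ t ∈ Set.Icc (0 : ℝ) 1, β + t • Δ ∈ segment ℝ β β' := by
    intro t ht
    rw [segment_eq_image']
    exact ⟨t, ht, rfl⟩
  have hN : 0 ≤ ‖Δ‖ ^ 2 := sq_nonneg _
  rw [hbreg]
  constructor
  · have := half_le_of_second_deriv_ge h1 h2
      (a := (lamRMinus + 0.5 * lamMinus) * ‖Δ‖ ^ 2) fun t ht => by
        have h3 := (hC.reg β hβ β' hβ' hs _ (hseg t ht) Δ).1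
        have h4 : lamMinus * ∑ i, c i * c i
            ≤ ∑ i, deriv (deriv fun u => l i u (y i)) (a i + t * c i) * c i * c i := by
          rw [Finset.mul_sum]
          refine Finset.sum_le_sum fun i _ => ?_
          rw [mul_assoc]
          exact mul_le_mul_of_nonneg_right (hC.loss_segment hconv hβ hβ' i ht).1
            (mul_self_nonneg _)
        have h5 := mul_le_mul_of_nonneg_left h4 (by positivity : 0 ≤ 1 / (n : ℝ))
        have h6 := mul_le_mul_of_nonneg_left hX1 hm0
        have h7 := mul_nonneg hm0 hN
        simp only [hφ'']
        nlinarith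
    linarith
  · have := second_deriv_le_half h1 h2
      (b := (lamRPlus + 1.4 * lamPlus) * ‖Δ‖ ^ 2) fun t ht => by
        have h3 := (hC.reg β hβ β' hβ' hs _ (hseg t ht) Δ).2
        have h4 : ∑ i, deriv (deriv fun u => l i u (y i)) (a i + t * c i) * c i * c i
            ≤ lamPlus * ∑ i, c i * c i := by
          rw [Finset.mul_sum]
          refine Finset.sum_le_sum fun i _ => ?_
          rw [mul_assoc]
          exact mul_le_mul_of_nonneg_right (hC.loss_segment hconv hβ hβ' i ht).2
            (mul_self_nonneg _)
        have h5 := mul_le_mul_of_nonneg_left h4 (by positivity : 0 ≤ 1 / (n : ℝ))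
        have h6 := mul_le_mul_of_nonneg_left hX2 hp0.le
        simp only [hφ'']
        nlinarith
    linarith

/-- At the origin the lower curvature bounds are at most the upper ones, provided that there is a
coordinate. -/
theorem CurvatureBounds.one_le_kappa
    (hC : CurvatureBounds l R X y s lamMinus lamPlus lamRMinus lamRPlus) (hn : 0 < n) (hd : 0 < d)
    (hm0 : 0 ≤ lamMinus) (hpos : 0 < lamRMinus + 0.5 * lamMinus) :
    1 ≤ kappa lamMinus lamPlus lamRMinus lamRPlus := by
  have h0 := zero_mem_sublevel (objective l R X y) s
  have h1 := hC.loss 0 h0 ⟨0, hn⟩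
  have h2 := hC.reg 0 h0 0 h0 (by simp [l0, supp_zero]) 0 (left_mem_segment ℝ 0 0)
    (EuclideanSpace.single ⟨0, hd⟩ (1 : ℝ))
  have h3 : ‖(EuclideanSpace.single ⟨0, hd⟩ (1 : ℝ) : Vec d)‖ = 1 := by simp
  rw [h3] at h2
  rw [kappa, one_le_div hpos]
  linarith [h1.1.trans h1.2, h2.1.trans h2.2]

end Curvature

/-! ### The constants `ρ₊`, `ρ₋` and the termination of the algorithm -/

section Rho

variable {d s : ℕ} {Q : Vec d → ℝ}

theorem rhoPlus_le {r : ℕ} {U : ℝ}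
    (h : ∀ β ∈ sublevel Q s, ∀ β' ∈ sublevel Q s, l0 (β' - β) ≤ r →
      bregman Q β β' ≤ U / 2 * ‖β' - β‖ ^ 2) : rhoPlus Q s r ≤ ENNReal.ofReal U := by
  refine iSup₂_le fun p hp => ENNReal.ofReal_le_ofReal ?_
  have hpos : 0 < ‖p.2 - p.1‖ := norm_pos_iff.2 (sub_ne_zero.2 hp.2.2.2.symm)
  rw [div_le_iff₀ (by positivity)]
  linarith [h p.1 hp.1 p.2 hp.2.1 hp.2.2.1]

theorem le_rhoMinus {r : ℕ} {m : ℝ}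
    (h : ∀ β ∈ sublevel Q s, ∀ β' ∈ sublevel Q s, l0 (β' - β) ≤ r →
      m / 2 * ‖β' - β‖ ^ 2 ≤ bregman Q β β') : ENNReal.ofReal m ≤ rhoMinus Q s r := by
  refine le_iInf₂ fun p hp => ENNReal.ofReal_le_ofReal ?_
  have hpos : 0 < ‖p.2 - p.1‖ := norm_pos_iff.2 (sub_ne_zero.2 hp.2.2.2.symm)
  rw [le_div_iff₀ (by positivity)]
  linarith [h p.1 hp.1 p.2 hp.2.1 hp.2.2.1]

theorem rhoPlus_mono {r r' : ℕ} (h : r ≤ r') : rhoPlus Q s r ≤ rhoPlus Q s r' :=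
  iSup₂_le fun p hp => le_iSup₂_of_le p ⟨hp.1, hp.2.1, hp.2.2.1.trans h, hp.2.2.2⟩ le_rfl

theorem bregman_le_of_rhoPlus {r : ℕ} (hfin : rhoPlus Q s r ≠ ⊤) {β β' : Vec d}
    (hβ : β ∈ sublevel Q s) (hβ' : β' ∈ sublevel Q s) (hr : l0 (β' - β) ≤ r) :
    bregman Q β β' ≤ (rhoPlus Q s r).toReal / 2 * ‖β' - β‖ ^ 2 := by
  rcases eq_or_ne β β' with rfl | hne
  · simp [bregman]
  have hpos : 0 < ‖β' - β‖ := norm_pos_iff.2 (sub_ne_zero.2 hne.symm)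
  have h1 : ENNReal.ofReal (2 * bregman Q β β' / ‖β' - β‖ ^ 2) ≤ rhoPlus Q s r :=
    le_iSup₂_of_le (β, β') ⟨hβ, hβ', hr, hne⟩ le_rfl
  rw [ENNReal.ofReal_le_iff_le_toReal hfin, div_le_iff₀ (by positivity)] at h1
  linarith

theorem le_bregman_of_rhoMinus {r : ℕ} {β β' : Vec d}
    (hβ : β ∈ sublevel Q s) (hβ' : β' ∈ sublevel Q s) (hr : l0 (β' - β) ≤ r)
    (h0 : 0 ≤ bregman Q β β') :
    (rhoMinus Q s r).toReal / 2 * ‖β' - β‖ ^ 2 ≤ bregman Q β β' := by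
  rcases eq_or_ne β β' with rfl | hne
  · simp [bregman]
  have hpos : 0 < ‖β' - β‖ := norm_pos_iff.2 (sub_ne_zero.2 hne.symm)
  have h1 : rhoMinus Q s r ≤ ENNReal.ofReal (2 * bregman Q β β' / ‖β' - β‖ ^ 2) :=
    iInf₂_le_of_le (β, β') ⟨hβ, hβ', hr, hne⟩ le_rfl
  have h2 := ENNReal.toReal_le_of_le_ofReal (by positivity) h1
  rw [le_div_iff₀ (by positivity)] at h2
  linarith

/-- Real constants that can replace `ρ₋(s)`, `ρ₊(s)` and `ρ₊(1)` in the analysis. If `ρ₋(s) = ∞`,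
the sublevel set contains no pair of distinct points, so that all constants work. -/
theorem exists_regular (hconv : ConvexOn ℝ Set.univ Q) (hd : Differentiable ℝ Q) (hs : 0 < s)
    {m₀ U κ : ℝ} (hm₀ : 0 < m₀) (hU : 0 < U) (hκ : U = κ * m₀)
    (hlow : ∀ β ∈ sublevel Q s, ∀ β' ∈ sublevel Q s, l0 (β' - β) ≤ s →
      m₀ / 2 * ‖β' - β‖ ^ 2 ≤ bregman Q β β')
    (hup : ∀ β ∈ sublevel Q s, ∀ β' ∈ sublevel Q s, l0 (β' - β) ≤ s →
      bregman Q β β' ≤ U / 2 * ‖β' - β‖ ^ 2) :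
    ∃ m V L : ℝ, Regular Q s m V L ∧ V ≤ κ * m ∧ L ≤ κ * m ∧
      (∀ βbar δ, AdmissibleDelta Q s βbar δ → 4 * L * gradSup Q βbar ^ 2 < δ * m ^ 2) ∧
      (∀ βbar ε, AdmissibleEps Q s βbar ε →
        2 * Real.sqrt 2 * L * gradSup Q βbar < ε * m) := by
  have hκ0 : 0 < κ := by
    by_contra! h
    nlinarith
  by_cases htop : rhoMinus Q s s = ⊤
  · have heq : ∀ β ∈ sublevel Q s, ∀ β' ∈ sublevel Q s, l0 (β' - β) ≤ s → β = β' := by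
      intro β hβ β' hβ' hl
      by_contra hne
      have : rhoMinus Q s s ≤ ENNReal.ofReal (2 * bregman Q β β' / ‖β' - β‖ ^ 2) :=
        iInf₂_le_of_le (β, β') ⟨hβ, hβ', hl, hne⟩ le_rfl
      rw [htop, top_le_iff] at this
      exact ENNReal.ofReal_ne_top this
    refine ⟨1, 0, 0, ⟨hconv, hd, one_pos, le_rfl, le_rfl, ?_, ?_, ?_⟩, by linarith, by linarith,
      fun _ δ h => by simpa using h.1, fun _ ε h => by simpa using h.1⟩
    · intro β hβ β' hβ' hl
      obtain rfl := heq β hβ β' hβ' hl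
      simp [bregman]
    · intro β hβ β' hβ' hl
      obtain rfl := heq β hβ β' hβ' hl
      simp [bregman]
    · intro β hβ β' hβ' hl
      obtain rfl := heq β hβ β' hβ' (hl.trans hs)
      simp [bregman]
  · set m := (rhoMinus Q s s).toReal with hm
    set L := (rhoPlus Q s 1).toReal with hL
    have hplus : rhoPlus Q s 1 ≤ ENNReal.ofReal U := (rhoPlus_mono hs).trans (rhoPlus_le hup)
    have hfin : rhoPlus Q s 1 ≠ ⊤ := ne_top_of_le_ne_top ENNReal.ofReal_ne_top hplus
    have hmm : m₀ ≤ m := by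
      rw [hm, ← ENNReal.ofReal_le_iff_le_toReal htop]
      exact le_rhoMinus hlow
    have hm0 : 0 < m := hm₀.trans_le hmm
    have hL0 : 0 ≤ L := ENNReal.toReal_nonneg
    have hLU : L ≤ U := ENNReal.toReal_le_of_le_ofReal hU.le hplus
    have hUm : U ≤ κ * m := by rw [hκ]; gcongr
    have hme : rhoMinus Q s s = ENNReal.ofReal m := (ENNReal.ofReal_toReal htop).symm
    have hLe : rhoPlus Q s 1 = ENNReal.ofReal L := (ENNReal.ofReal_toReal hfin).symm
    have hΓ : ∀ βbar, 0 ≤ gradSup Q βbar := fun _ => norm_nonneg _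
    refine ⟨m, U, L, ⟨hconv, hd, hm0, hU.le, hL0, ?_, hup, ?_⟩, hUm, hLU.trans hUm, ?_, ?_⟩
    · intro β hβ β' hβ' hl
      refine le_bregman_of_rhoMinus hβ hβ' hl (le_trans ?_ (hlow β hβ β' hβ' hl))
      positivity
    · intro β hβ β' hβ' hl
      exact bregman_le_of_rhoPlus hfin hβ hβ' hl
    · intro βbar δ h
      have h2 := h.2
      rw [hme, hLe, ← ENNReal.ofReal_pow hm0.le,
        show (4 : ℝ≥0∞) = ENNReal.ofReal 4 by simp, ← ENNReal.ofReal_mul (by norm_num),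
        ← ENNReal.ofReal_div_of_pos (by positivity), ← ENNReal.ofReal_mul (by positivity),
        ENNReal.ofReal_lt_ofReal_iff h.1, div_mul_eq_mul_div, div_lt_iff₀ (by positivity)] at h2
      exact h2
    · intro βbar ε h
      have h2 := h.2
      rw [hme, hLe, ← ENNReal.ofReal_mul (by positivity),
        ← ENNReal.ofReal_div_of_pos (by positivity), ← ENNReal.ofReal_mul (by positivity),
        ENNReal.ofReal_lt_ofReal_iff h.1, div_mul_eq_mul_div, div_lt_iff₀ (by positivity)] at h2
      exact h2

theorem levelBound_add_one_le_iterBound {κ : ℝ} (hκ : 1 ≤ κ) (kbar : ℕ) :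
    levelBound κ kbar + 1 ≤ iterBound κ kbar := by
  have h1 : 1 ≤ Real.sqrt κ := Real.one_le_sqrt.2 hκ
  set t := (1 + Real.sqrt κ) ^ 2 * κ ^ 2 with ht
  have ht1 : 1 ≤ t := by
    have h2 : 1 ≤ (1 + Real.sqrt κ) ^ 2 := one_le_pow₀ (by linarith)
    have h3 : 1 ≤ κ ^ 2 := one_le_pow₀ hκ
    rw [ht]
    nlinarith
  have h4 : iterBound κ kbar = 4 * (kbar + 1) * t := by rw [iterBound, ht]; ring
  rw [h4, levelBound, ← ht]
  have : (0 : ℝ) ≤ kbar := Nat.cast_nonneg _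
  nlinarith

/-- Restricted strong convexity and smoothness imply the termination bounds. The smoothness bound
is assumed with a constant `U' < U` to get the strict inequality of the sparsity condition. -/
theorem terminationBounds_of_bregman_bounds (hconv : ConvexOn ℝ Set.univ Q)
    (hd : Differentiable ℝ Q) (hs : 0 < s) {m₀ U' U : ℝ} (hm₀ : 0 < m₀) (hU' : 0 ≤ U')
    (hUU : U' < U) (hκ1 : 0 < d → 1 ≤ U / m₀)
    (hlow : ∀ β ∈ sublevel Q s, ∀ β' ∈ sublevel Q s, l0 (β' - β) ≤ s →
      m₀ / 2 * ‖β' - β‖ ^ 2 ≤ bregman Q β β')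
    (hup : ∀ β ∈ sublevel Q s, ∀ β' ∈ sublevel Q s, l0 (β' - β) ≤ s →
      bregman Q β β' ≤ U' / 2 * ‖β' - β‖ ^ 2) :
    TerminationBounds Q s (U / m₀) := by
  have hU : 0 < U := hU'.trans_lt hUU
  set κ := U / m₀ with hκ
  have hκ0 : 0 < κ := div_pos hU hm₀
  intro kbar hk
  refine ⟨?_, fun βbar hbar hmin => ?_⟩
  · have hplus := rhoPlus_le hup
    have hminus := le_rhoMinus hlow
    have hplus1 : rhoPlus Q s 1 ≤ ENNReal.ofReal U' := (rhoPlus_mono hs).trans hplus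
    have hcond : condNumber Q s ≤ ENNReal.ofReal κ := by
      rw [hκ, ENNReal.ofReal_div_of_pos hm₀]
      exact ENNReal.div_le_div (hplus.trans (ENNReal.ofReal_le_ofReal hUU.le)) hminus
    have hsqrt : condNumber Q s ^ (1 / 2 : ℝ) ≤ ENNReal.ofReal (Real.sqrt κ) := by
      rw [Real.sqrt_eq_rpow, ← ENNReal.ofReal_rpow_of_nonneg hκ0.le (by norm_num)]
      exact ENNReal.rpow_le_rpow hcond (by norm_num)
    have hquot : 2 * rhoPlus Q s 1 / rhoMinus Q s s ≤ ENNReal.ofReal (2 * U' / m₀) := by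
      rw [ENNReal.ofReal_div_of_pos hm₀, ENNReal.ofReal_mul (by norm_num)]
      refine ENNReal.div_le_div ?_ hminus
      simpa using mul_le_mul_right hplus1 2
    rw [SparsityCondition]
    calc _ ≤ ((kbar : ℝ≥0∞) + 1) * ((ENNReal.ofReal (Real.sqrt κ) + 1)
          * ENNReal.ofReal (2 * U' / m₀)) ^ 2 := by gcongr
      _ = ENNReal.ofReal ((kbar + 1) * ((Real.sqrt κ + 1) * (2 * U' / m₀)) ^ 2) := by
          rw [ENNReal.ofReal_mul (by positivity), ENNReal.ofReal_pow (by positivity),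
            ENNReal.ofReal_mul (by positivity), ENNReal.ofReal_add (by positivity) zero_le_one,
            ENNReal.ofReal_add (by positivity) zero_le_one]
          simp
      _ < ENNReal.ofReal ((s : ℝ) - kbar) := by
          have h1 : ((kbar : ℝ) + 1) * ((Real.sqrt κ + 1) * (2 * U' / m₀)) ^ 2
              < iterBound κ kbar := by
            have h2 : 2 * U' / m₀ < 2 * κ := by
              rw [hκ, ← mul_div_assoc]
              gcongr
            have h3 : 0 ≤ 2 * U' / m₀ := by positivity
            have h4 : (kbar + 1 : ℝ) * ((Real.sqrt κ + 1) * (2 * U' / m₀)) ^ 2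
                < (kbar + 1) * ((Real.sqrt κ + 1) * (2 * κ)) ^ 2 := by gcongr
            rw [iterBound]
            linarith
          have h5 : 0 ≤ ((kbar : ℝ) + 1) * ((Real.sqrt κ + 1) * (2 * U' / m₀)) ^ 2 := by
            positivity
          rw [ENNReal.ofReal_lt_ofReal_iff (by linarith)]
          linarith
  · have hiter0 : 0 ≤ iterBound κ kbar := by unfold iterBound; positivity
    rcases Nat.eq_zero_or_pos d with rfl | hd0
    · exact ⟨fun δ _ => terminatesWithin_dim_zero Q _ δ hiter0,
        fun ε _ => terminatesWithin_dim_zero Q _ ε hiter0⟩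
    have hlevel := levelBound_add_one_le_iterBound (hκ1 hd0) kbar
    obtain ⟨m, V, L, hreg, hV, hL, hdelta, heps⟩ := exists_regular hconv hd hs hm₀ hU
      (κ := κ) (by rw [hκ, div_mul_cancel₀ _ hm₀.ne']) hlow fun β hβ β' hβ' hl =>
        (hup β hβ β' hβ' hl).trans (by gcongr)
    have hL0 := hreg.L_nonneg
    have hm := hreg.m_pos
    constructor
    · intro δ hδ
      have hS : GreedySetting Q s m V L κ kbar βbar .obj δ δ :=
        ⟨hreg, hV, hL, by linarith, hbar, hmin, hδ.1, hδ.1, hdelta βbar δ hδ, le_rfl⟩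
      exact hS.terminatesWithin (by linarith)
    · intro ε hε
      have h1 := heps βbar ε hε
      have hε0 := hε.1
      have hΓ : 0 ≤ gradSup Q βbar := norm_nonneg _
      -- If `L = 0`, no forward step takes place and the threshold is arbitrary.
      obtain ⟨δ₀, hδ₀, hnoise, hgain⟩ : ∃ δ₀ : ℝ, 0 < δ₀ ∧
          4 * L * gradSup Q βbar ^ 2 < δ₀ * m ^ 2 ∧ GainThreshold L ε δ₀ .gdt := by
        rcases hL0.eq_or_lt with h0 | h0
        · refine ⟨1, one_pos, by rw [← h0]; simp; positivity, fun g hg => ?_⟩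
          rw [← h0] at hg
          have : 0 < ε ^ 2 := by positivity
          linarith
        · refine ⟨ε ^ 2 / (2 * L), by positivity, ?_, fun g hg => ?_⟩
          · rw [div_mul_eq_mul_div, lt_div_iff₀ (by positivity), ← mul_pow]
            have h2 := pow_lt_pow_left₀ h1 (by positivity) two_ne_zero
            have h3 : Real.sqrt 2 ^ 2 = 2 := Real.sq_sqrt (by norm_num)
            have h4 : (2 * Real.sqrt 2 * L * gradSup Q βbar) ^ 2
                = 4 * L * gradSup Q βbar ^ 2 * (2 * L) := by
              calc _ = 4 * Real.sqrt 2 ^ 2 * L ^ 2 * gradSup Q βbar ^ 2 := by ring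
                _ = _ := by rw [h3]; ring
            rwa [h4] at h2
          · rw [div_le_iff₀ (by positivity)]
            linarith
      have hS : GreedySetting Q s m V L κ kbar βbar .gdt ε δ₀ :=
        ⟨hreg, hV, hL, by linarith, hbar, hmin, hε0, hδ₀, hnoise, hgain⟩
      exact hS.terminatesWithin (by linarith)

end Rho

/-- On the event that `X` is a restricted isometry, all conclusions hold. -/
theorem conclusion_of_restrictedIsometry {n d s : ℕ} {l : Fin n → ℝ → ℝ → ℝ} {R : Vec d → ℝ}
    {X : Matrix (Fin n) (Fin d) ℝ} {y : Fin n → ℝ} {lamMinus lamPlus lamRMinus lamRPlus : ℝ}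
    (hn : 0 < n) (hs : 0 < s) (hl : ∀ i v, Differentiable ℝ fun u => l i u v)
    (hl' : ∀ i v, Differentiable ℝ (deriv fun u => l i u v))
    (hR : Differentiable ℝ R) (hR' : Differentiable ℝ (fderiv ℝ R))
    (hm0 : 0 ≤ lamMinus) (hp0 : 0 < lamPlus) (hRp0 : 0 ≤ lamRPlus)
    (hpos : 0 < lamRMinus + 0.5 * lamMinus) (hX : RestrictedIsometry X s)
    (hconv : ConvexOn ℝ Set.univ (objective l R X y))
    (hC : CurvatureBounds l R X y s lamMinus lamPlus lamRMinus lamRPlus) :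
    RSCBounds (objective l R X y) s lamMinus lamPlus lamRMinus lamRPlus ∧
      TerminationBounds (objective l R X y) s (kappa lamMinus lamPlus lamRMinus lamRPlus) := by
  have hb := fun β hβ β' hβ' hs =>
    bregman_bounds hn hl hl' hR hR' hm0 hp0 hX hconv hC (β := β) (β' := β') hβ hβ' hs
  have hlow := fun β hβ β' hβ' hs => (hb β hβ β' hβ' hs).1
  have hup := fun β hβ β' hβ' hs => (hb β hβ β' hβ' hs).2
  have hlt : lamRPlus + 1.4 * lamPlus < lamRPlus + 1.5 * lamPlus := by linarith
  have hplus := (rhoPlus_le hup).trans (ENNReal.ofReal_le_ofReal hlt.le)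
  have hminus := le_rhoMinus hlow
  refine ⟨⟨hplus, hminus, ?_⟩, ?_⟩
  · rw [kappa, ENNReal.ofReal_div_of_pos hpos]
    exact ENNReal.div_le_div hplus hminus
  · exact terminationBounds_of_bregman_bounds hconv (differentiable_objective hl hR) hs hpos
      (by linarith) hlt (fun hd => hC.one_le_kappa hn hd hm0 hpos) hlow hup

end FoBa

theorem theorem5 (K : ℝ) (hK : 0 < K) :
    ∃ C : ℝ, 0 < C ∧ ∀ η : ℝ, 0 < η → ∃ N : ℕ, ∀ n d s : ℕ,
      N ≤ n → 0 < s → s < n → C * s * Real.log d ≤ n →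
      ∀ (Ω : Type*) [MeasurableSpace Ω] (μ : Measure Ω) [IsProbabilityMeasure μ]
        (X : Ω → Matrix (Fin n) (Fin d) ℝ) (y : Ω → Fin n → ℝ)
        (l : Fin n → ℝ → ℝ → ℝ) (R : FoBa.Vec d → ℝ)
        (lamMinus lamPlus lamRMinus lamRPlus : ℝ),
        FoBa.IndepRows μ X K ∨ FoBa.IndepCols μ X K →
        (∀ i v, ConvexOn ℝ Set.univ fun u => l i u v) →
        (∀ i v, Differentiable ℝ fun u => l i u v) →
        (∀ i v, Differentiable ℝ (deriv fun u => l i u v)) →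
        Differentiable ℝ R → Differentiable ℝ (fderiv ℝ R) →
        0 ≤ lamMinus → 0 < lamPlus → 0 ≤ lamRMinus → 0 ≤ lamRPlus →
        0 < lamRMinus + 0.5 * lamMinus →
        μ {ω | ConvexOn ℝ Set.univ (FoBa.objective l R (X ω) (y ω)) ∧
            FoBa.CurvatureBounds l R (X ω) (y ω) s lamMinus lamPlus lamRMinus lamRPlus ∧
            ¬ (FoBa.RSCBounds (FoBa.objective l R (X ω) (y ω)) s
                lamMinus lamPlus lamRMinus lamRPlus ∧
              FoBa.TerminationBounds (FoBa.objective l R (X ω) (y ω)) s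
                (FoBa.kappa lamMinus lamPlus lamRMinus lamRPlus))}
          ≤ ENNReal.ofReal η := by
  obtain ⟨C, hC, h⟩ := FoBa.exists_measure_not_restrictedIsometry_le K hK
  refine ⟨C, hC, fun η hη => ?_⟩
  obtain ⟨N, hN⟩ := h η hη
  refine ⟨N, fun n d s hNn hs hsn hCn Ω _ μ _ X y l R lamMinus lamPlus lamRMinus lamRPlus
    hX _ hl hl' hR hR' hm0 hp0 _ hRp0 hpos => ?_⟩
  have hn : 0 < n := hs.trans hsn
  refine (measure_mono ?_).trans (hN n d s hNn hn hCn Ω μ X hX)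
  rintro ω ⟨hconv, hcurv, hfail⟩ hiso
  exact hfail (FoBa.conclusion_of_restrictedIsometry hn hs hl hl' hR hR' hm0 hp0 hRp0 hpos hiso
    hconv hcurv)
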